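/- Let $I=(a,b)$ with $-\infty<a<b<\infty$, and let $L(I)$ be the space of Lebesgue measurable real functions on $I$ modulo equality a.e. A Banach function space (BFS) on $I$ is a Banach space $E=\{f\in L(I):\|f\|_E<\infty\}$, where $\|\cdot\|_E$ is a norm defined on all of $L(I)$ with values in $[0,\infty]$, such that $\||f|\|_E=\|f\|_E$; $0\le f\le g$ a.e. implies $\|f\|_E\le\|g\|_E$; $0\le f_n\uparrow f$ a.e. implies $\|f_n\|_E\uparrow\|f\|_E$; and $L^\infty(I)\subset E\subset L^1(I)$. Its associate space $E'$ consists of the $g\in L(I)$ with $\|g\|_{E'}=\sup\{\|fg\|_{L^1}:\|f\|_E\le1\}<\infty$, and $E^*$ is the Banach dual of $E$. The space $E'$ has absolutely continuous (AC) norm if $\|g\chi_{X_n}\|_{E'}\to0$ for every $g\in E'$ and all measurable sets $X_n\subset I$ with $\chi_{X_n}\to0$ a.e. The space $E$ satisfies (min) if there is a constant $C>0$ such that for every $f\in E$ and every countable family $\{I_i\}$ of disjoint non-degenerate intervals with union $I$ (up to a null set) $$\frac1C\|f\|_E\le\Big\|\sum_i\frac{\|f\chi_{I_i}\|_E}{\|\chi_{I_i}\|_E}\chi_{I_i}\Big\|_E\le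 C\|f\|_E .$$ For measurable $u,v:I\to[0,\infty)$ that vanish only on null sets, with $u\in E'$ and $v\in E$, put $Tf(x)=v(x)\int_a^xf(t)u(t)\,dt$ and, for an open interval $J\subset I$ and $c\in[a,b]$, $$T_{c,J}f(x)=v(x)\chi_J(x)\int_c^xf(t)u(t)\chi_J(t)\,dt,\qquad \mathcal A(J)=\sup_{f\in E,\ f\chi_J\ne0}\ \inf_{\alpha\in\mathbb R}\frac{\|(T_{c,J}f-\alpha v)\chi_J\|_E}{\|f\chi_J\|_E};$$ $\mathcal A(J)$ does not depend on $c$, and $\|T_{c,J}\|$ is the norm of $T_{c,J}$ as an operator on $E(J)=\{f\chi_J:f\in E\}$ (equivalently, on $E$). For a bounded linear $S:E\to E$ let $$a_n(S)=\inf\{\|S-P\|:\ P:E\to E \text{ bounded linear},\ \operatorname{rank}P<n\},\qquad i_n(S)=\sup\|A\|^{-1}\|B\|^{-1},$$ the supremum being over all Banach spaces $G$ with $\dim G\ge n$ and bounded linear maps $A:E\to G$, $B:G\to E$ such that $ASB$ is the identity on $G$ ($i_n(S)=0$ if there are none). **Theorem.** Let $E$ be a strictly convex BFS on $I$ that satisfies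 (min), let $E^*$ be strictly convex, and let $E'$ have AC norm. Then there are constants $C_1,C_2>0$, depending only on $E$, such that for all $u,v$ as above and every integer $N>1$ there exist $\varepsilon_N>0$ and points $a=a_0<a_1<\dots<a_N=b$ with $$\mathcal A((a_{i-1},a_i))=\varepsilon_N\quad(i=2,\dots,N),\qquad \|T_{a,(a,a_1)}\|=\varepsilon_N,$$ and $$C_1\varepsilon_N\le a_N(T)\le C_2\varepsilon_N,\qquad C_1\varepsilon_N\le i_N(T)\le C_2\varepsilon_N,\qquad C_1\,i_N(T)\le a_N(T)\le C_2\,i_N(T).$$ -/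

import Mathlib

open MeasureTheory Set Filter Topology
open scoped ENNReal NNReal

namespace HardyBFS

/-- Lebesgue measure on the interval `I = (a, b)`. -/
noncomputable abbrev vol (a b : ℝ) : Measure ℝ := volume.restrict (Ioo a b)

/-- `L(I)`: Lebesgue measurable real functions on `I = (a, b)`, modulo equality a.e. -/
abbrev L0 (a b : ℝ) : Type := ℝ →ₘ[vol a b] ℝ

/-- The class of the characteristic function of a measurable set. -/
noncomputable def chi (a b : ℝ) (s : Set ℝ) (hs : MeasurableSet s) : L0 a b :=
  AEEqFun.mk (s.indicator fun _ => (1 : ℝ))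
    (stronglyMeasurable_const.indicator hs).aestronglyMeasurable

/-- A Banach function space on `I = (a, b)`. The norm is defined on all measurable functions, with
values in `[0, ∞]`; the space consists of the functions of finite norm. -/
structure BFS (a b : ℝ) where
  /-- the norm, extended by `∞` outside the space -/
  nrm : L0 a b → ℝ≥0∞
  nrm_eq_zero_iff : ∀ f, nrm f = 0 ↔ f = 0
  nrm_add_le : ∀ f g, nrm (f + g) ≤ nrm f + nrm g
  nrm_smul : ∀ (c : ℝ) (f), nrm (c • f) = ‖c‖ₑ * nrm f
  nrm_abs : ∀ f, nrm |f| = nrm f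
  nrm_mono : ∀ f g, 0 ≤ f → f ≤ g → nrm f ≤ nrm g
  nrm_fatou : ∀ (f : ℕ → L0 a b) (g : L0 a b), (∀ n, 0 ≤ f n) → Monotone f →
    (∀ᵐ x ∂vol a b, Tendsto (fun n => f n x) atTop (𝓝 (g x))) →
    Tendsto (fun n => nrm (f n)) atTop (𝓝 (nrm g))
  nrm_lt_top_of_memLp_top : ∀ f : L0 a b, MemLp f ∞ (vol a b) → nrm f < ∞
  integrable_of_nrm_lt_top : ∀ f : L0 a b, nrm f < ∞ → Integrable f (vol a b)
  complete : ∀ f : ℕ → L0 a b, (∀ n, nrm (f n) < ∞) →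
    (∀ ε : ℝ≥0∞, 0 < ε → ∃ k, ∀ m ≥ k, ∀ n ≥ k, nrm (f m - f n) < ε) →
    ∃ g, nrm g < ∞ ∧ Tendsto (fun n => nrm (f n - g)) atTop (𝓝 0)

/-- Absolute continuity of an extended norm `ρ` on `L(I)`. -/
def HasACNorm {a b : ℝ} (ρ : L0 a b → ℝ≥0∞) : Prop :=
  ∀ f : L0 a b, ρ f < ∞ → ∀ (X : ℕ → Set ℝ) (hX : ∀ n, MeasurableSet (X n)),
    (∀ᵐ x ∂vol a b, Tendsto (fun n => (X n).indicator (fun _ => (1 : ℝ)) x) atTop (𝓝 0)) →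
    Tendsto (fun n => ρ (chi a b (X n) (hX n) * f)) atTop (𝓝 0)

/-- A countable family of disjoint non-degenerate open intervals `(p.1, p.2)` contained in
`I = (a, b)`, whose union is `I` up to a null set. -/
structure IntervalPartition (a b : ℝ) where
  parts : Set (ℝ × ℝ)
  countable : parts.Countable
  lt : ∀ p ∈ parts, p.1 < p.2
  subset : ∀ p ∈ parts, Ioo p.1 p.2 ⊆ Ioo a b
  disjoint : parts.PairwiseDisjoint fun p => Ioo p.1 p.2
  cover : volume (Ioo a b \ ⋃ p ∈ parts, Ioo p.1 p.2) = 0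

namespace BFS

variable {a b : ℝ} (E : BFS a b)

/-- The norm of the associate space `E'`, which consists of the `g` of finite associate norm. -/
noncomputable def assocNrm (g : L0 a b) : ℝ≥0∞ :=
  ⨆ (f : L0 a b) (_ : E.nrm f ≤ 1), ∫⁻ x, ‖f x * g x‖ₑ ∂vol a b

/-- The step function `∑ᵢ (‖f χ_{Iᵢ}‖ / ‖χ_{Iᵢ}‖) χ_{Iᵢ}` of a partition `{Iᵢ}`. (At every point
at most one term of the sum is not zero.) -/
noncomputable def avg (Q : IntervalPartition a b) (f : L0 a b) : L0 a b :=
  AEEqFun.mk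
    (fun x => (∑' p : Q.parts, (Ioo p.1.1 p.1.2).indicator
      (fun _ => E.nrm (chi a b (Ioo p.1.1 p.1.2) measurableSet_Ioo * f) /
        E.nrm (chi a b (Ioo p.1.1 p.1.2) measurableSet_Ioo)) x).toReal)
    (by
      have : Countable Q.parts := Q.countable.to_subtype
      exact (Measurable.ennreal_toReal (Measurable.tsum fun p =>
        measurable_const.indicator measurableSet_Ioo)).aestronglyMeasurable)

/-- The condition `(min)`: `C⁻¹ ‖f‖ ≤ ‖∑ᵢ (‖f χ_{Iᵢ}‖ / ‖χ_{Iᵢ}‖) χ_{Iᵢ}‖ ≤ C ‖f‖`, with `C`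
independent of `f` in the space and of the partition. -/
def SatisfiesMin : Prop :=
  ∃ C : ℝ≥0, 0 < C ∧ ∀ (Q : IntervalPartition a b) (f : L0 a b), E.nrm f < ∞ →
    E.nrm f ≤ C * E.nrm (E.avg Q f) ∧ E.nrm (E.avg Q f) ≤ C * E.nrm f

/-! ### The space as a normed space -/

/-- The functions of finite norm, as a subspace of `L(I)`. -/
def submodule : Submodule ℝ (L0 a b) where
  carrier := {f | E.nrm f < ∞}
  add_mem' {f g} hf hg := (E.nrm_add_le f g).trans_lt (ENNReal.add_lt_top.2 ⟨hf, hg⟩)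
  zero_mem' := by
    show E.nrm 0 < ∞
    rw [(E.nrm_eq_zero_iff 0).2 rfl]
    exact ENNReal.zero_lt_top
  smul_mem' c f hf := by
    show E.nrm (c • f) < ∞
    rw [E.nrm_smul]
    exact ENNReal.mul_lt_top enorm_lt_top hf

/-- The Banach space `E`, with the norm `‖f‖ = E.nrm f`. -/
def Space : Type := E.submodule

/-- The underlying function class. -/
def Space.val {E : BFS a b} (f : E.Space) : L0 a b := Subtype.val f

/-- A function of finite norm as an element of the space. -/
def toSpace (f : L0 a b) (hf : E.nrm f < ∞) : E.Space := ⟨f, hf⟩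

theorem Space.nrm_lt_top {E : BFS a b} (f : E.Space) : E.nrm f.val < ∞ := Subtype.property f

noncomputable instance : AddCommGroup E.Space := inferInstanceAs (AddCommGroup E.submodule)

noncomputable instance : Module ℝ E.Space := inferInstanceAs (Module ℝ E.submodule)

noncomputable instance : Norm E.Space := ⟨fun f => (E.nrm f.val).toReal⟩

theorem norm_def (f : E.Space) : ‖f‖ = (E.nrm f.val).toReal := rfl

theorem normCore : NormedSpace.Core ℝ E.Space where
  norm_nonneg f := ENNReal.toReal_nonneg
  norm_smul c f := by
    show (E.nrm (c • f.val)).toReal = _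
    rw [E.nrm_smul, ENNReal.toReal_mul, toReal_enorm]
    rfl
  norm_triangle f g := by
    show (E.nrm (f.val + g.val)).toReal ≤ (E.nrm f.val).toReal + (E.nrm g.val).toReal
    rw [← ENNReal.toReal_add f.nrm_lt_top.ne g.nrm_lt_top.ne]
    exact ENNReal.toReal_mono (ENNReal.add_lt_top.2 ⟨f.nrm_lt_top, g.nrm_lt_top⟩).ne
      (E.nrm_add_le _ _)
  norm_eq_zero_iff f := by
    show (E.nrm f.val).toReal = 0 ↔ f = 0
    rw [ENNReal.toReal_eq_zero_iff, or_iff_left f.nrm_lt_top.ne, E.nrm_eq_zero_iff]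
    exact ⟨fun h => Subtype.ext h, fun h => by rw [h]; rfl⟩

noncomputable instance : NormedAddCommGroup E.Space := NormedAddCommGroup.ofCore E.normCore

noncomputable instance : NormedSpace ℝ E.Space := {
  norm_smul_le := fun c f => (E.normCore.norm_smul c f).le }

/-! ### The Hardy-type operators -/

theorem nrm_le_of_abs_le {f g : L0 a b} (h : ∀ᵐ x ∂vol a b, |f x| ≤ |g x|) :
    E.nrm f ≤ E.nrm g := by
  rw [← E.nrm_abs f, ← E.nrm_abs g]
  refine E.nrm_mono _ _ ?_ ?_
  · rw [← AEEqFun.coeFn_le]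
    filter_upwards [AEEqFun.coeFn_abs f, AEEqFun.coeFn_zero (μ := vol a b) (α := ℝ) (β := ℝ)]
      with x h1 h2
    rw [h1, h2]
    exact abs_nonneg _
  rw [← AEEqFun.coeFn_le]
  filter_upwards [h, AEEqFun.coeFn_abs f, AEEqFun.coeFn_abs g] with x h1 h2 h3
  rw [h2, h3]
  exact h1

theorem abs_chi_mul_le (s : Set ℝ) (hs : MeasurableSet s) (f : L0 a b) :
    ∀ᵐ x ∂vol a b, |(chi a b s hs * f : L0 a b) x| ≤ |f x| := by
  filter_upwards [AEEqFun.coeFn_mul (chi a b s hs) f,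
    AEEqFun.coeFn_mk (μ := vol a b) (s.indicator fun _ => (1 : ℝ))
      (stronglyMeasurable_const.indicator hs).aestronglyMeasurable] with x h1 h2
  have h3 : (chi a b s hs : L0 a b) x = s.indicator (fun _ => (1 : ℝ)) x := h2
  rw [h1, Pi.mul_apply, h3]
  by_cases hx : x ∈ s <;> simp [hx]

theorem nrm_chi_mul_lt_top (s : Set ℝ) (hs : MeasurableSet s) {f : L0 a b} (hf : E.nrm f < ∞) :
    E.nrm (chi a b s hs * f) < ∞ :=
  (E.nrm_le_of_abs_le (abs_chi_mul_le s hs f)).trans_lt hf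

theorem assocNrm_chi_mul_lt_top (s : Set ℝ) (hs : MeasurableSet s) {g : L0 a b}
    (hg : E.assocNrm g < ∞) : E.assocNrm (chi a b s hs * g) < ∞ := by
  refine lt_of_le_of_lt (iSup₂_mono fun f _ => lintegral_mono_ae ?_) hg
  filter_upwards [abs_chi_mul_le s hs g] with x hx
  rw [enorm_mul, enorm_mul]
  gcongr
  exact enorm_le_iff_norm_le.2 hx

/-- Hölder's inequality. -/
theorem lintegral_mul_le (f g : L0 a b) (hf : E.nrm f < ∞) :
    ∫⁻ x, ‖f x * g x‖ₑ ∂vol a b ≤ E.nrm f * E.assocNrm g := by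
  by_cases h0 : E.nrm f = 0
  · have hf0 := (E.nrm_eq_zero_iff f).1 h0
    have : ∫⁻ x, ‖f x * g x‖ₑ ∂vol a b = 0 := by
      rw [← lintegral_zero (μ := vol a b)]
      refine lintegral_congr_ae ?_
      rw [hf0]
      filter_upwards [AEEqFun.coeFn_zero (μ := vol a b) (α := ℝ) (β := ℝ)] with x hx
      rw [hx]; simp
    rw [this]; exact zero_le
  · set r : ℝ := (E.nrm f).toReal with hr
    have hrpos : 0 < r := ENNReal.toReal_pos h0 hf.ne
    have hre : ‖r‖ₑ = E.nrm f := by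
      rw [Real.enorm_eq_ofReal hrpos.le, hr, ENNReal.ofReal_toReal hf.ne]
    have hri : ‖r⁻¹‖ₑ = (E.nrm f)⁻¹ := by rw [enorm_inv hrpos.ne', hre]
    have h1 : E.nrm (r⁻¹ • f) ≤ 1 := by
      rw [E.nrm_smul, hri, ENNReal.inv_mul_cancel h0 hf.ne]
    have h2 : ∫⁻ x, ‖(r⁻¹ • f : L0 a b) x * g x‖ₑ ∂vol a b ≤ E.assocNrm g :=
      le_iSup₂ (f := fun (f : L0 a b) (_ : E.nrm f ≤ 1) => ∫⁻ x, ‖f x * g x‖ₑ ∂vol a b)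
        (r⁻¹ • f) h1
    have h3 : ∫⁻ x, ‖f x * g x‖ₑ ∂vol a b
        = E.nrm f * ∫⁻ x, ‖(r⁻¹ • f : L0 a b) x * g x‖ₑ ∂vol a b := by
      rw [← lintegral_const_mul' _ _ hf.ne]
      refine lintegral_congr_ae ?_
      filter_upwards [AEEqFun.coeFn_smul r⁻¹ f] with x hx
      rw [hx, Pi.smul_apply, smul_eq_mul, mul_assoc, enorm_mul r⁻¹, hri, ← mul_assoc,
        ENNReal.mul_inv_cancel h0 hf.ne, one_mul]
    rw [h3]
    gcongr

theorem integrable_mul (f : E.Space) {u : L0 a b} (hu : E.assocNrm u < ∞) :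
    Integrable (fun t => f.val t * u t) (vol a b) :=
  ⟨f.val.aestronglyMeasurable.mul u.aestronglyMeasurable,
    (E.lintegral_mul_le f.val u f.nrm_lt_top).trans_lt (ENNReal.mul_lt_top f.nrm_lt_top hu)⟩

/-- The function class `x ↦ v(x) ∫_c^x f(t) u(t) dt`, for `f ∈ E` and `u ∈ E'`. -/
noncomputable def hardyFun (c : ℝ) (u v : L0 a b) (hu : E.assocNrm u < ∞) (f : E.Space) :
    L0 a b :=
  AEEqFun.mk (fun x => v x * ∫ t in c..x, f.val t * u t ∂vol a b)
    (v.aestronglyMeasurable.mul (intervalIntegral.continuous_primitive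
      (fun _ _ => (E.integrable_mul f hu).intervalIntegrable) c).aestronglyMeasurable)

theorem coeFn_hardyFun (c : ℝ) (u v : L0 a b) (hu : E.assocNrm u < ∞) (f : E.Space) :
    ∀ᵐ x ∂vol a b, E.hardyFun c u v hu f x = v x * ∫ t in c..x, f.val t * u t ∂vol a b :=
  AEEqFun.coeFn_mk _ _

theorem abs_primitive_le (c x : ℝ) (u : L0 a b) (hu : E.assocNrm u < ∞) (f : E.Space) :
    |∫ t in c..x, f.val t * u t ∂vol a b| ≤ ‖f‖ * (E.assocNrm u).toReal := by
  calc |∫ t in c..x, f.val t * u t ∂vol a b|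
      ≤ ∫ t in uIoc c x, ‖f.val t * u t‖ ∂vol a b :=
        (Real.norm_eq_abs _).symm.trans_le intervalIntegral.norm_integral_le_integral_norm_uIoc
    _ ≤ ∫ t, ‖f.val t * u t‖ ∂vol a b :=
        setIntegral_le_integral (E.integrable_mul f hu).norm
          (Eventually.of_forall fun _ => norm_nonneg _)
    _ = (∫⁻ t, ‖f.val t * u t‖ₑ ∂vol a b).toReal :=
        integral_norm_eq_lintegral_enorm (E.integrable_mul f hu).1
    _ ≤ (E.nrm f.val * E.assocNrm u).toReal :=
        ENNReal.toReal_mono (ENNReal.mul_lt_top f.nrm_lt_top hu).ne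
          (E.lintegral_mul_le _ _ f.nrm_lt_top)
    _ = ‖f‖ * (E.assocNrm u).toReal := ENNReal.toReal_mul

theorem nrm_hardyFun_le (c : ℝ) (u v : L0 a b) (hu : E.assocNrm u < ∞) (f : E.Space) :
    E.nrm (E.hardyFun c u v hu f) ≤ ‖‖f‖ * (E.assocNrm u).toReal‖ₑ * E.nrm v := by
  rw [← E.nrm_smul]
  refine E.nrm_le_of_abs_le ?_
  filter_upwards [E.coeFn_hardyFun c u v hu f,
    AEEqFun.coeFn_smul (‖f‖ * (E.assocNrm u).toReal) v] with x h1 h2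
  rw [h1, h2, Pi.smul_apply, smul_eq_mul, abs_mul, abs_mul (‖f‖ * _), mul_comm]
  refine mul_le_mul_of_nonneg_right ?_ (abs_nonneg _)
  exact (E.abs_primitive_le c x u hu f).trans (le_abs_self _)

theorem nrm_hardyFun_lt_top (c : ℝ) (u v : L0 a b) (hu : E.assocNrm u < ∞) (hv : E.nrm v < ∞)
    (f : E.Space) : E.nrm (E.hardyFun c u v hu f) < ∞ :=
  (E.nrm_hardyFun_le c u v hu f).trans_lt (ENNReal.mul_lt_top enorm_lt_top hv)

theorem val_add (f g : E.Space) : (f + g).val = f.val + g.val := rfl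

theorem val_smul (r : ℝ) (f : E.Space) : (r • f).val = r • f.val := rfl

/-- The Hardy-type operator `f ↦ v(x) ∫_c^x f(t) u(t) dt`, a bounded linear map of `E` to itself
when `u ∈ E'` and `v ∈ E`. -/
noncomputable def hardy (c : ℝ) (u v : L0 a b) (hu : E.assocNrm u < ∞) (hv : E.nrm v < ∞) :
    E.Space →L[ℝ] E.Space :=
  LinearMap.mkContinuous
    { toFun := fun f => E.toSpace (E.hardyFun c u v hu f) (E.nrm_hardyFun_lt_top c u v hu hv f)
      map_add' := fun f g => by
        refine Subtype.ext ?_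
        show E.hardyFun c u v hu (f + g) = E.hardyFun c u v hu f + E.hardyFun c u v hu g
        refine AEEqFun.ext ?_
        filter_upwards [E.coeFn_hardyFun c u v hu (f + g), E.coeFn_hardyFun c u v hu f,
          E.coeFn_hardyFun c u v hu g,
          AEEqFun.coeFn_add (E.hardyFun c u v hu f) (E.hardyFun c u v hu g)] with x h1 h2 h3 h4
        rw [h4, Pi.add_apply, h1, h2, h3, ← mul_add, ← intervalIntegral.integral_add
          (E.integrable_mul f hu).intervalIntegrable (E.integrable_mul g hu).intervalIntegrable]
        congr 1
        refine intervalIntegral.integral_congr_ae ?_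
        filter_upwards [AEEqFun.coeFn_add f.val g.val] with t ht _
        rw [val_add, ht, Pi.add_apply, add_mul]
      map_smul' := fun r f => by
        refine Subtype.ext ?_
        show E.hardyFun c u v hu (r • f) = r • E.hardyFun c u v hu f
        refine AEEqFun.ext ?_
        filter_upwards [E.coeFn_hardyFun c u v hu (r • f), E.coeFn_hardyFun c u v hu f,
          AEEqFun.coeFn_smul r (E.hardyFun c u v hu f)] with x h1 h2 h3
        rw [h3, Pi.smul_apply, h1, h2, smul_eq_mul, mul_left_comm,
          ← intervalIntegral.integral_const_mul r]
        congr 1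
        refine intervalIntegral.integral_congr_ae ?_
        filter_upwards [AEEqFun.coeFn_smul r f.val] with t ht _
        rw [val_smul, ht, Pi.smul_apply, smul_eq_mul, mul_assoc] }
    ((E.assocNrm u).toReal * (E.nrm v).toReal)
    (fun f => by
      show (E.nrm (E.hardyFun c u v hu f)).toReal ≤ _
      refine (ENNReal.toReal_mono (ENNReal.mul_lt_top enorm_lt_top hv).ne
        (E.nrm_hardyFun_le c u v hu f)).trans (le_of_eq ?_)
      have h0 : 0 ≤ ‖f‖ * (E.assocNrm u).toReal :=
        mul_nonneg ENNReal.toReal_nonneg ENNReal.toReal_nonneg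
      rw [ENNReal.toReal_mul, toReal_enorm, Real.norm_of_nonneg h0]
      ring)

/-- Multiplication by the characteristic function of the interval `J = (x, y)`. For `f ∈ E` the
norm `‖f‖_{E(J)}` is `‖E.cut x y f‖`. -/
noncomputable def cut (x y : ℝ) (f : E.Space) : E.Space :=
  E.toSpace (chi a b (Ioo x y) measurableSet_Ioo * f.val)
    (E.nrm_chi_mul_lt_top _ _ f.nrm_lt_top)

/-- The operator `T_{c,J} f = v χ_J ∫_c^· f u χ_J` for `J = (x, y)`. Since `T_{c,J} f` depends only
on `f χ_J` and vanishes outside `J`, its norm on `E(J)` is its operator norm on `E`. -/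
noncomputable def hardyOn (c x y : ℝ) (u v : L0 a b) (hu : E.assocNrm u < ∞)
    (hv : E.nrm v < ∞) : E.Space →L[ℝ] E.Space :=
  E.hardy c (chi a b (Ioo x y) measurableSet_Ioo * u) (chi a b (Ioo x y) measurableSet_Ioo * v)
    (E.assocNrm_chi_mul_lt_top _ _ hu) (E.nrm_chi_mul_lt_top _ _ hv)

/-- `𝒜(J) = sup_f inf_α ‖T_{c,J} f - α v‖_{E(J)} / ‖f‖_{E(J)}` for `J = (x, y)`; the supremum is
over the `f ∈ E` that do not vanish a.e. on `J`. -/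
noncomputable def calA (c x y : ℝ) (u v : L0 a b) (hu : E.assocNrm u < ∞)
    (hv : E.nrm v < ∞) : ℝ :=
  ⨆ f : {f : E.Space // E.cut x y f ≠ 0}, ⨅ α : ℝ,
    ‖E.cut x y (E.hardyOn c x y u v hu hv f.1 - α • E.toSpace v hv)‖ / ‖E.cut x y f.1‖

end BFS

/-! ### Approximation and isomorphism numbers -/

/-- The `n`th approximation number of a bounded operator. -/
noncomputable def approxNumber {X : Type} [NormedAddCommGroup X] [NormedSpace ℝ X] (n : ℕ)
    (S : X →L[ℝ] X) : ℝ :=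
  sInf {r | ∃ P : X →L[ℝ] X, LinearMap.rank (P : X →ₗ[ℝ] X) < n ∧ r = ‖S - P‖}

/-- The `n`th isomorphism number of a bounded operator (zero if there is no factorization of the
identity of an at least `n`-dimensional Banach space through `S`). As `B` embeds `G` in `X`, it is
enough to let `G` range over the universe of `X`. -/
noncomputable def isoNumber {X : Type} [NormedAddCommGroup X] [NormedSpace ℝ X] (n : ℕ)
    (S : X →L[ℝ] X) : ℝ :=
  sSup {r | ∃ (G : Type) (_ : NormedAddCommGroup G) (_ : NormedSpace ℝ G) (_ : CompleteSpace G)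
    (A : X →L[ℝ] G) (B : G →L[ℝ] X), (n : Cardinal) ≤ Module.rank ℝ G ∧
      (A ∘L S ∘L B) = ContinuousLinearMap.id ℝ G ∧ r = ‖A‖⁻¹ * ‖B‖⁻¹}

end HardyBFS

namespace HardyBFS
namespace BFS

variable {a b : ℝ} (E : BFS a b)

/-! ### Restriction to measurable sets -/

/-! Everything happens on one partition. On an interval `J`, moving the base point of the primitive
changes `χ_J T f` only by a multiple of `v` (`hardyOn_eq_cut`). So `calA` measures how far `T f`
stays on `J` from the line spanned by `v`; on the initial interval the base point is `a` and the
norm of the operator itself is used.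

A partition with equal values exists because both interval functions are monotone, continuous in the
end points, zero on degenerate intervals and positive on the others (`exists_equal_partition`).
Continuity rests on order continuity of `E`: shrinking an interval end changes the quantities by at
most a multiple of the norm of `v` on a short interval (`calA_le_add`). Order continuity follows
from strict convexity of the dual (`exists_norm_restr_lt`): otherwise some function has infinitely
many disjoint pieces of norm bounded below, and two of their subfamilies carry distinct functionals
of norm at most one whose sum has norm at least two.

The condition (min) turns estimates on the single intervals into one on all of `I`, with a constant
`K` depending only on `E` (`SatisfiesMin.exists_norm_le`). For the upper bound, subtract from `T f`
a nearly best multiple of `v`, chosen linearly, on each interval but the first; this has rank at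
most `N - 1` and leaves an error of at most `2 ε` times `f` on each interval
(`approxNumber_hardy_le`). For the lower bound, take a nearly extremal function on each interval,
with a functional that kills `v` there and so ignores what the other functions contribute. These
functionals invert `T` on the span of the `N` functions (`le_isoNumber_hardy`). Finally
`isoNumber_le_approxNumber` holds for every operator, since a map of rank below `N` has a kernel on
any space of dimension at least `N`. -/

theorem norm_le_of_abs_le {f g : E.Space} (h : ∀ᵐ x ∂vol a b, |f.val x| ≤ |g.val x|) :
    ‖f‖ ≤ ‖g‖ :=
  ENNReal.toReal_mono g.nrm_lt_top.ne (E.nrm_le_of_abs_le h)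

theorem Space.ext_ae {E : BFS a b} {f g : E.Space} (h : ∀ᵐ x ∂vol a b, f.val x = g.val x) :
    f = g :=
  Subtype.ext (AEEqFun.ext h)

theorem coeFn_add (f g : E.Space) : ∀ᵐ x ∂vol a b, (f + g).val x = f.val x + g.val x :=
  AEEqFun.coeFn_add f.val g.val

theorem coeFn_sub (f g : E.Space) : ∀ᵐ x ∂vol a b, (f - g).val x = f.val x - g.val x :=
  AEEqFun.coeFn_sub f.val g.val

theorem coeFn_smul (r : ℝ) (f : E.Space) : ∀ᵐ x ∂vol a b, (r • f).val x = r * f.val x :=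
  AEEqFun.coeFn_smul r f.val

theorem coeFn_zero : ∀ᵐ x ∂vol a b, (0 : E.Space).val x = 0 :=
  AEEqFun.coeFn_zero (μ := vol a b) (α := ℝ) (β := ℝ)

theorem coeFn_chi_mul (s : Set ℝ) (hs : MeasurableSet s) (f : L0 a b) :
    ∀ᵐ x ∂vol a b, (chi a b s hs * f : L0 a b) x = s.indicator f x := by
  filter_upwards [AEEqFun.coeFn_mul (chi a b s hs) f,
    AEEqFun.coeFn_mk (μ := vol a b) (s.indicator fun _ => (1 : ℝ))
      (stronglyMeasurable_const.indicator hs).aestronglyMeasurable] with x h1 h2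
  have h3 : (chi a b s hs : L0 a b) x = s.indicator (fun _ => (1 : ℝ)) x := h2
  rw [h1, Pi.mul_apply, h3]
  by_cases hx : x ∈ s <;> simp [hx]

/-- Multiplication by the characteristic function of a measurable set. -/
noncomputable def restr (s : Set ℝ) (hs : MeasurableSet s) : E.Space →L[ℝ] E.Space :=
  LinearMap.mkContinuous
    { toFun := fun f => E.toSpace (chi a b s hs * f.val) (E.nrm_chi_mul_lt_top s hs f.nrm_lt_top)
      map_add' := fun f g => by
        refine Subtype.ext (AEEqFun.ext ?_)
        filter_upwards [coeFn_chi_mul s hs (f + g).val, coeFn_chi_mul s hs f.val,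
          coeFn_chi_mul s hs g.val, AEEqFun.coeFn_add (chi a b s hs * f.val)
          (chi a b s hs * g.val), E.coeFn_add f g] with x h1 h2 h3 h4 h5
        refine h1.trans (Eq.trans ?_ h4.symm)
        rw [Pi.add_apply, h2, h3]
        by_cases hx : x ∈ s <;> simp [hx, h5]
      map_smul' := fun r f => by
        refine Subtype.ext (AEEqFun.ext ?_)
        filter_upwards [coeFn_chi_mul s hs (r • f).val, coeFn_chi_mul s hs f.val,
          AEEqFun.coeFn_smul r (chi a b s hs * f.val), E.coeFn_smul r f] with x h1 h2 h3 h4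
        refine h1.trans (Eq.trans ?_ h3.symm)
        rw [Pi.smul_apply, h2]
        by_cases hx : x ∈ s <;> simp [hx, h4] }
    1 (fun f => by
      rw [one_mul]
      exact E.norm_le_of_abs_le (abs_chi_mul_le s hs f.val))

theorem cut_eq_restr (x y : ℝ) (f : E.Space) :
    E.cut x y f = E.restr (Ioo x y) measurableSet_Ioo f := rfl

theorem coeFn_restr (s : Set ℝ) (hs : MeasurableSet s) (f : E.Space) :
    ∀ᵐ x ∂vol a b, (E.restr s hs f).val x = s.indicator f.val x :=
  coeFn_chi_mul s hs f.val

theorem coeFn_cut (x y : ℝ) (f : E.Space) :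
    ∀ᵐ t ∂vol a b, (E.cut x y f).val t = (Ioo x y).indicator f.val t :=
  coeFn_chi_mul _ measurableSet_Ioo f.val

theorem norm_restr_le (s : Set ℝ) (hs : MeasurableSet s) (f : E.Space) : ‖E.restr s hs f‖ ≤ ‖f‖ :=
  E.norm_le_of_abs_le (abs_chi_mul_le s hs f.val)

theorem norm_cut_le (x y : ℝ) (f : E.Space) : ‖E.cut x y f‖ ≤ ‖f‖ := E.norm_restr_le _ _ f

theorem norm_restr_mono_ae {s t : Set ℝ} (hs : MeasurableSet s) (ht : MeasurableSet t)
    (h : ∀ᵐ x ∂vol a b, x ∈ s → x ∈ t) (f : E.Space) : ‖E.restr s hs f‖ ≤ ‖E.restr t ht f‖ := by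
  refine E.norm_le_of_abs_le ?_
  filter_upwards [h, E.coeFn_restr s hs f, E.coeFn_restr t ht f] with x h0 h1 h2
  rw [h1, h2]
  by_cases hx : x ∈ s
  · simp [hx, h0 hx]
  · simp [hx]

theorem norm_restr_mono {s t : Set ℝ} (hs : MeasurableSet s) (ht : MeasurableSet t)
    (h : s ⊆ t) (f : E.Space) : ‖E.restr s hs f‖ ≤ ‖E.restr t ht f‖ :=
  E.norm_restr_mono_ae hs ht (Eventually.of_forall h) f

theorem norm_le_restr_add {s t r : Set ℝ} (hs : MeasurableSet s) (ht : MeasurableSet t)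
    (hr : MeasurableSet r) (h : s ⊆ t ∪ r) (f : E.Space) :
    ‖E.restr s hs f‖ ≤ ‖E.restr t ht f‖ + ‖E.restr r hr f‖ := by
  have hd : MeasurableSet (s \ t) := hs.diff ht
  have key : E.restr s hs f = E.restr (s ∩ t) (hs.inter ht) f + E.restr (s \ t) hd f := by
    refine Space.ext_ae ?_
    filter_upwards [E.coeFn_restr s hs f, E.coeFn_restr _ (hs.inter ht) f, E.coeFn_restr _ hd f,
      E.coeFn_add (E.restr (s ∩ t) (hs.inter ht) f) (E.restr (s \ t) hd f)] with x h1 h2 h3 h4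
    rw [h4, h1, h2, h3]
    by_cases hx : x ∈ s <;> by_cases hy : x ∈ t <;> simp [hx, hy]
  rw [key]
  refine (norm_add_le _ _).trans (add_le_add (E.norm_restr_mono _ _ inter_subset_right f)
    (E.norm_restr_mono _ _ ?_ f))
  intro x hx
  exact (h hx.1).resolve_left hx.2

/-! ### Order continuity of a space with strictly convex dual -/

/-- Turns the separating constant of Hahn–Banach into a bound on the dual norm: the ball is
symmetric, so the one-sided bound controls `|φ|`. -/
theorem norm_mul_le_of_ball {X : Type*} [NormedAddCommGroup X] [NormedSpace ℝ X]
    {φ : StrongDual ℝ X} {c s : ℝ} (hc : 0 < c) (h : ∀ g ∈ Metric.ball (0 : X) c, φ g < s) :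
    ‖φ‖ * c ≤ s := by
  by_contra! hlt
  obtain ⟨x, hx, hx'⟩ := φ.exists_lt_apply_of_lt_opNorm ((div_lt_iff₀ hc).2 hlt)
  rw [div_lt_iff₀ hc] at hx'
  have hball : ∀ y : X, ‖y‖ < 1 → φ y * c < s := fun y hy => by
    have := h (c • y) (by
      rw [mem_ball_zero_iff, norm_smul, Real.norm_of_nonneg hc.le]
      nlinarith [norm_nonneg y])
    rwa [map_smul, smul_eq_mul, mul_comm] at this
  have h1 := hball x hx
  have h2 := hball (-x) (by rwa [norm_neg])
  rw [map_neg] at h2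
  rcases abs_cases (φ x) with ⟨h3, _⟩ | ⟨h3, _⟩ <;> rw [Real.norm_eq_abs, h3] at hx' <;> linarith

/-- A functional that is uniformly large on a decreasing sequence of nonnegative functions. -/
theorem exists_dual_of_antitone (x : ℕ → E.Space)
    (h0 : ∀ n, ∀ᵐ t ∂vol a b, 0 ≤ (x n).val t)
    (hx : ∀ m n, m ≤ n → ∀ᵐ t ∂vol a b, (x n).val t ≤ (x m).val t) {c : ℝ} (hc : 0 < c)
    (hxc : ∀ n, c ≤ ‖x n‖) :
    ∃ φ : StrongDual ℝ E.Space, ‖φ‖ ≤ 1 ∧ ∀ n, c ≤ φ (x n) := by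
  -- The functions above some `x n`. The sequence decreases, so this set is convex; all its members
  -- have norm at least `c`, so it can be separated from the open ball of radius `c`.
  set S : Set E.Space := {g | ∃ n, ∀ᵐ t ∂vol a b, (x n).val t ≤ g.val t} with hS
  have hconv : Convex ℝ S := by
    rintro f ⟨m, hm⟩ g ⟨n, hn⟩ r s hr hs hrs
    refine ⟨max m n, ?_⟩
    filter_upwards [hm, hn, hx m _ (le_max_left m n), hx n _ (le_max_right m n),
      E.coeFn_add (r • f) (s • g), E.coeFn_smul r f, E.coeFn_smul s g] with t h1 h2 h3 h4 h5 h6 h7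
    rw [h5, h6, h7]
    calc (x (max m n)).val t = r * (x (max m n)).val t + s * (x (max m n)).val t := by
          rw [← add_mul, hrs, one_mul]
      _ ≤ _ := add_le_add (mul_le_mul_of_nonneg_left (h3.trans h1) hr)
          (mul_le_mul_of_nonneg_left (h4.trans h2) hs)
  have hdisj : Disjoint (Metric.ball (0 : E.Space) c) S := by
    rw [Set.disjoint_left]
    rintro g hg ⟨n, hn⟩
    rw [mem_ball_zero_iff] at hg
    have : ‖x n‖ ≤ ‖g‖ := by
      refine E.norm_le_of_abs_le ?_
      filter_upwards [hn, h0 n] with t h1 h2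
      rw [abs_of_nonneg h2]
      exact h1.trans (le_abs_self _)
    linarith [hxc n]
  obtain ⟨φ, s, hφ, hs⟩ := geometric_hahn_banach_open (convex_ball 0 c) Metric.isOpen_ball
    hconv hdisj
  have hxS : ∀ n, s ≤ φ (x n) := fun n => hs _ ⟨n, Eventually.of_forall fun _ => le_rfl⟩
  have hs0 : 0 < s := by simpa using hφ 0 (Metric.mem_ball_self hc)
  have hnorm : ‖φ‖ * c ≤ s := norm_mul_le_of_ball hc hφ
  have hφ0 : 0 < ‖φ‖ := by
    refine norm_pos_iff.2 fun h => ?_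
    have := hxS 0
    rw [h] at this
    simp at this
    linarith
  refine ⟨‖φ‖⁻¹ • φ, ?_, fun n => ?_⟩
  · rw [norm_smul, norm_inv, norm_norm, inv_mul_cancel₀ hφ0.ne']
  · show c ≤ ‖φ‖⁻¹ * φ (x n)
    rw [inv_mul_eq_div, le_div_iff₀ hφ0, mul_comm]
    exact hnorm.trans (hxS n)

/-- An almost monotone set function on the infinite subsets of `ℕ` becomes constant on the infinite
subsets of a suitable infinite set. -/
theorem exists_infinite_forall_subset_eq (q : Set ℕ → ℝ) (hq0 : ∀ A, 0 ≤ q A)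
    (hq : ∀ A B, (B \ A).Finite → q B ≤ q A) :
    ∃ A : Set ℕ, A.Infinite ∧ ∀ B ⊆ A, B.Infinite → q B = q A := by
  let I (A : Set ℕ) : Set ℝ := q '' {B | B ⊆ A ∧ B.Infinite}
  have hI : ∀ A, BddBelow (I A) := fun A => ⟨0, by rintro _ ⟨B, _, rfl⟩; exact hq0 B⟩
  -- Diagonal argument: each new set nearly minimizes `q` over the infinite subsets of the previous
  -- one, with error `1 / (k + 1)`.
  have hstep : ∀ (k : ℕ) (A : {A : Set ℕ // A.Infinite}), ∃ B : {A : Set ℕ // A.Infinite},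
      B.1 ⊆ A.1 ∧ q B.1 < sInf (I A.1) + 1 / ((k : ℝ) + 1) := by
    intro k A
    have hne : (I A.1).Nonempty := ⟨q A.1, A.1, ⟨Subset.rfl, A.2⟩, rfl⟩
    obtain ⟨_, ⟨B, hB, rfl⟩, hlt⟩ := exists_lt_of_csInf_lt hne
      (show sInf (I A.1) < sInf (I A.1) + 1 / ((k : ℝ) + 1) by
        have : (0 : ℝ) < 1 / ((k : ℝ) + 1) := by positivity
        linarith)
    exact ⟨⟨B, hB.2⟩, hB.1, hlt⟩
  choose next hsub hlt using hstep
  let F : ℕ → {A : Set ℕ // A.Infinite} := fun n =>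
    Nat.rec ⟨univ, infinite_univ⟩ (fun k A => next k A) n
  have hF : ∀ n, F (n + 1) = next n (F n) := fun n => rfl
  have hanti : Antitone fun n => (F n).1 := antitone_nat_of_succ_le fun n => hsub n (F n)
  have hex : ∀ n m : ℕ, ∃ k ∈ (F n).1, m < k := fun n m => (F n).2.exists_gt m
  choose g hgmem hglt using hex
  -- A strictly increasing choice of one point from each `F n`; its range lies in every `F n` up to
  -- finitely many points.
  let s : ℕ → ℕ := fun n => Nat.rec (g 0 0) (fun k m => g (k + 1) m) n
  have hsmem : ∀ n, s n ∈ (F n).1 := by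
    intro n
    cases n with
    | zero => exact hgmem 0 0
    | succ k => exact hgmem (k + 1) (s k)
  have hsmono : StrictMono s := strictMono_nat_of_lt_succ fun n => hglt (n + 1) (s n)
  have hfin : ∀ n, (range s \ (F n).1).Finite := by
    intro n
    refine ((finite_Iio n).image s).subset ?_
    rintro _ ⟨⟨k, rfl⟩, hk⟩
    refine ⟨k, ?_, rfl⟩
    by_contra h
    exact hk (hanti (not_lt.1 h) (hsmem k))
  refine ⟨range s, infinite_range_of_injective hsmono.injective, fun B hB hBinf => ?_⟩
  refine le_antisymm (hq _ _ (by rw [sdiff_eq_empty.2 hB]; exact finite_empty)) ?_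
  refine le_of_forall_pos_le_add fun δ hδ => ?_
  obtain ⟨k, hk⟩ := exists_nat_one_div_lt hδ
  have h1 : q (range s) ≤ q (F (k + 1)).1 := hq _ _ (hfin (k + 1))
  have h2 : q (F (k + 1)).1 < sInf (I (F k).1) + 1 / ((k : ℝ) + 1) := hlt k (F k)
  -- `B` is almost contained in `F k`, so the intersection is still infinite and competes in the
  -- infimum.
  have h3 : sInf (I (F k).1) ≤ q (B ∩ (F k).1) := by
    refine csInf_le (hI _) ⟨_, ⟨inter_subset_right, ?_⟩, rfl⟩
    have : (B \ (F k).1).Finite := (hfin k).subset (sdiff_subset_sdiff_left hB)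
    intro h
    refine hBinf ((h.union this).subset ?_)
    rw [inter_union_sdiff]
  have h4 : q (B ∩ (F k).1) ≤ q B := hq _ _ (by
    rw [sdiff_eq_empty.2 inter_subset_left]; exact finite_empty)
  linarith

/-- The Fatou property, for differences of decreasing sets. -/
theorem exists_lt_norm_restr_diff (w : E.Space) (hw : ∀ᵐ t ∂vol a b, 0 ≤ w.val t) (X : ℕ → Set ℝ)
    (hX : ∀ n, MeasurableSet (X n)) (hanti : Antitone X) (hempty : ⋂ n, X n = ∅) {r : ℝ} (n : ℕ)
    (hr : r < ‖E.restr (X n) (hX n) w‖) :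
    ∃ m > n, r < ‖E.restr (X n \ X m) ((hX n).diff (hX m)) w‖ := by
  have hlim : Tendsto (fun m => E.nrm (E.restr (X n \ X m) ((hX n).diff (hX m)) w).val) atTop
      (𝓝 (E.nrm (E.restr (X n) (hX n) w).val)) := by
    have hall : ∀ᵐ t ∂vol a b, ∀ m, (E.restr (X n \ X m) ((hX n).diff (hX m)) w).val t =
        (X n \ X m).indicator w.val t := ae_all_iff.2 fun m => E.coeFn_restr _ _ w
    refine E.nrm_fatou _ _ (fun m => ?_) (fun m k hmk => ?_) ?_
    · rw [← AEEqFun.coeFn_le]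
      filter_upwards [hall, hw, AEEqFun.coeFn_zero (μ := vol a b) (α := ℝ) (β := ℝ)]
        with t h1 h2 h3
      rw [h1, h3]
      exact indicator_nonneg (fun _ _ => h2) _ |>.trans_eq rfl
    · rw [← AEEqFun.coeFn_le]
      filter_upwards [hall, hw] with t h1 h2
      rw [h1, h1]
      by_cases ht : t ∈ X n \ X m
      · have : t ∈ X n \ X k := ⟨ht.1, fun h => ht.2 (hanti hmk h)⟩
        simp only [indicator_of_mem ht, indicator_of_mem this, le_refl]
      · rw [indicator_of_notMem ht]
        by_cases ht' : t ∈ X n \ X k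
        · rw [indicator_of_mem ht']; exact h2
        · rw [indicator_of_notMem ht']
    · filter_upwards [hall, E.coeFn_restr (X n) (hX n) w] with t h1 h2
      have : ∃ m, t ∉ X m := by
        by_contra! h
        have : t ∈ ⋂ n, X n := mem_iInter.2 h
        rw [hempty] at this
        exact this
      obtain ⟨m, hm⟩ := this
      refine tendsto_const_nhds.congr' ?_
      filter_upwards [eventually_ge_atTop m] with k hk
      rw [h1, h2]
      have hk' : t ∉ X k := fun h => hm (hanti hk h)
      by_cases ht : t ∈ X n <;> simp [ht, hk']
  have hlim' := (ENNReal.tendsto_toReal (E.restr (X n) (hX n) w).nrm_lt_top.ne).comp hlim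
  obtain ⟨m, hm, hm'⟩ := ((hlim'.eventually_const_lt hr).and (eventually_gt_atTop n)).exists
  exact ⟨m, hm', hm⟩

/-- If all pieces had norm at least `δ`, pass to an infinite index set `A` whose infinite subsets
all have the same limiting tail norm `c > 0`. Split `A` in two infinite halves. A functional that is
at least `c` on all tails of one half is asymptotically zero on the other, as the tails of `A` also
have norms tending to `c`. The two functionals obtained add up to norm at least two, against strict
convexity of the dual. -/
theorem norm_restr_biUnion_lt [StrictConvexSpace ℝ (StrongDual ℝ E.Space)] (w : E.Space)
    (hw : ∀ᵐ t ∂vol a b, 0 ≤ w.val t) (X : ℕ → Set ℝ) (hX : ∀ n, MeasurableSet (X n))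
    (hdisj : Pairwise (fun i j => Disjoint (X i) (X j))) {δ : ℝ} (hδ : 0 < δ) :
    ∃ k, ‖E.restr (X k) (hX k) w‖ < δ := by
  by_contra! hbig
  let Y : Set ℕ → Set ℝ := fun A => ⋃ k ∈ A, X k
  have hY : ∀ A, MeasurableSet (Y A) := fun A => MeasurableSet.biUnion A.to_countable fun k _ => hX k
  have hYmono : ∀ {A B : Set ℕ}, A ⊆ B → Y A ⊆ Y B := fun h => biUnion_subset_biUnion_left h
  have hYdisj : ∀ {A B : Set ℕ}, Disjoint A B → Disjoint (Y A) (Y B) := by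
    intro A B h
    simp only [Y, disjoint_iUnion_left, disjoint_iUnion_right]
    intro j hj k hk
    exact hdisj fun e => disjoint_left.1 h (e ▸ hk) hj
  let x : Set ℕ → E.Space := fun A => E.restr (Y A) (hY A) w
  have hxmono : ∀ {A B : Set ℕ}, A ⊆ B → ‖x A‖ ≤ ‖x B‖ := fun h =>
    E.norm_restr_mono _ _ (hYmono h) w
  -- The limiting tail norm; it ignores finitely many indices, which gives the almost monotonicity
  -- needed for the diagonal argument.
  let q : Set ℕ → ℝ := fun A => ⨅ n, ‖x (A ∩ Ici n)‖
  have hbdd : ∀ A : Set ℕ, BddBelow (range fun n => ‖x (A ∩ Ici n)‖) := fun A =>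
    ⟨0, by rintro _ ⟨n, rfl⟩; exact norm_nonneg _⟩
  obtain ⟨A, hA, hAq⟩ := exists_infinite_forall_subset_eq q
    (fun A => le_ciInf fun n => norm_nonneg _) (by
      intro A B hfin
      refine le_ciInf fun n => ?_
      obtain ⟨m, hm⟩ := hfin.bddAbove
      refine (ciInf_le (hbdd B) (max n (m + 1))).trans (hxmono ?_)
      rintro k ⟨hkB, hk⟩
      rw [mem_Ici, max_le_iff] at hk
      refine ⟨?_, hk.1⟩
      by_contra hkA
      have := hm ⟨hkB, hkA⟩
      omega)
  set c := q A with hc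
  have hcpos : 0 < c := by
    refine hδ.trans_le (le_ciInf fun n => ?_)
    obtain ⟨k, hk, hnk⟩ := hA.exists_gt n
    refine (hbig k).trans (E.norm_restr_mono _ _ ?_ w)
    exact subset_biUnion_of_mem (u := X) (show k ∈ A ∩ Ici n from ⟨hk, hnk.le⟩)
  have hfun : ∀ B ⊆ A, B.Infinite → ∃ φ : StrongDual ℝ E.Space, ‖φ‖ ≤ 1 ∧
      ∀ n, c ≤ φ (x (B ∩ Ici n)) := by
    intro B hB hBinf
    refine E.exists_dual_of_antitone _ (fun n => ?_) (fun m n hmn => ?_) hcpos (fun n => ?_)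
    · filter_upwards [hw, E.coeFn_restr _ (hY (B ∩ Ici n)) w] with t h1 h2
      rw [h2]
      exact indicator_nonneg (fun _ _ => h1) _ |>.trans_eq rfl
    · filter_upwards [hw, E.coeFn_restr _ (hY (B ∩ Ici n)) w, E.coeFn_restr _ (hY (B ∩ Ici m)) w]
        with t h1 h2 h3
      rw [h2, h3]
      by_cases ht : t ∈ Y (B ∩ Ici n)
      · have : t ∈ Y (B ∩ Ici m) :=
          hYmono (inter_subset_inter_right _ (Ici_subset_Ici.2 hmn)) ht
        rw [indicator_of_mem ht, indicator_of_mem this]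
      · rw [indicator_of_notMem ht]
        by_cases ht' : t ∈ Y (B ∩ Ici m)
        · rw [indicator_of_mem ht']; exact h1
        · rw [indicator_of_notMem ht']
    · rw [← hAq B hB hBinf]
      exact ciInf_le (hbdd B) n
  have hcross : ∀ B D : Set ℕ, B ⊆ A → D ⊆ A → Disjoint B D → ∀ φ : StrongDual ℝ E.Space,
      ‖φ‖ ≤ 1 → (∀ n, c ≤ φ (x (B ∩ Ici n))) → ∀ n,
      |φ (x (D ∩ Ici n))| ≤ ‖x (A ∩ Ici n)‖ - c := by
    intro B D hB hD hBD φ hφ hφB n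
    -- Changing the sign on the piece over `D` does not change absolute values, so the combination
    -- is still dominated by the tail over `A`.
    have hle : ∀ s : ℝ, |s| = 1 → φ (x (B ∩ Ici n)) + s * φ (x (D ∩ Ici n))
        ≤ ‖x (A ∩ Ici n)‖ := by
      intro s hs
      have h1 : φ (x (B ∩ Ici n)) + s * φ (x (D ∩ Ici n))
          = φ (x (B ∩ Ici n) + s • x (D ∩ Ici n)) := by rw [map_add, map_smul, smul_eq_mul]
      rw [h1]
      refine (le_abs_self _).trans ((φ.le_opNorm _).trans ?_)
      refine (mul_le_of_le_one_left (norm_nonneg _) hφ).trans (E.norm_le_of_abs_le ?_)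
      filter_upwards [E.coeFn_add (x (B ∩ Ici n)) (s • x (D ∩ Ici n)),
        E.coeFn_smul s (x (D ∩ Ici n)), E.coeFn_restr _ (hY (B ∩ Ici n)) w,
        E.coeFn_restr _ (hY (D ∩ Ici n)) w, E.coeFn_restr _ (hY (A ∩ Ici n)) w]
        with t h2 h3 h4 h5 h6
      rw [h2, h3, h4, h5, h6]
      by_cases ht : t ∈ Y (B ∩ Ici n)
      · have ht1 : t ∈ Y (A ∩ Ici n) := hYmono (inter_subset_inter_left _ hB) ht
        have ht2 : t ∉ Y (D ∩ Ici n) := disjoint_left.1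
          (hYdisj (hBD.mono inter_subset_left inter_subset_left)) ht
        simp [ht, ht1, ht2]
      · by_cases ht2 : t ∈ Y (D ∩ Ici n)
        · have ht1 : t ∈ Y (A ∩ Ici n) := hYmono (inter_subset_inter_left _ hD) ht2
          simp [ht, ht1, ht2, abs_mul, hs]
        · simp [ht, ht2]
    have h1 := hle 1 (by simp)
    have h2 := hle (-1) (by simp)
    have h3 := hφB n
    rw [abs_le]
    constructor <;> linarith
  let e := hA.natEmbedding
  have hinj : Function.Injective fun k => (e k : ℕ) := Subtype.val_injective.comp e.injective
  let B₁ : Set ℕ := range fun k => (e (2 * k) : ℕ)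
  let B₂ : Set ℕ := range fun k => (e (2 * k + 1) : ℕ)
  have hB₁ : B₁ ⊆ A := by rintro _ ⟨k, rfl⟩; exact (e _).2
  have hB₂ : B₂ ⊆ A := by rintro _ ⟨k, rfl⟩; exact (e _).2
  have hB₁' : B₁.Infinite := infinite_range_of_injective fun i j h => by
    have := hinj h; omega
  have hB₂' : B₂.Infinite := infinite_range_of_injective fun i j h => by
    have := hinj h; omega
  have hB : Disjoint B₁ B₂ := by
    rw [disjoint_left]
    rintro _ ⟨i, rfl⟩ ⟨j, h⟩
    have := hinj h
    omega
  obtain ⟨φ, hφ, hφB⟩ := hfun B₁ hB₁ hB₁'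
  obtain ⟨ψ, hψ, hψB⟩ := hfun B₂ hB₂ hB₂'
  have hφ2 := hcross B₁ B₂ hB₁ hB₂ hB φ hφ hφB
  have hψ1 := hcross B₂ B₁ hB₂ hB₁ hB.symm ψ hψ hψB
  have hne : φ ≠ ψ := by
    intro h
    obtain ⟨n, hn⟩ := exists_lt_of_ciInf_lt (show q A < 2 * c by linarith)
    have h1 := (abs_le.1 (hφ2 n)).2
    have h2 := hψB n
    rw [← h] at h2
    linarith
  have hlt : ‖φ + ψ‖ < 2 := by
    have h := norm_combo_lt_of_ne hφ hψ hne (one_half_pos (α := ℝ)) one_half_pos (add_halves 1)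
    rw [← smul_add, norm_smul, Real.norm_of_nonneg one_half_pos.le] at h
    linarith
  -- With `X` the norm of the tail over `A`, the two diagonal terms give `2 c` and the cross terms
  -- cost at most `2 (X - c)`. So `‖φ + ψ‖ X ≥ 4 c - 2 X`; letting the tails shrink, `X` tends to
  -- `c` and `‖φ + ψ‖ ≥ 2`.
  have hge : ∀ n, 4 * c / (2 + ‖φ + ψ‖) ≤ ‖x (A ∩ Ici n)‖ := by
    intro n
    rw [div_le_iff₀ (by positivity)]
    have h1 := (le_abs_self _).trans ((φ + ψ).le_opNorm (x (B₁ ∩ Ici n) + x (B₂ ∩ Ici n)))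
    have h2 : ‖x (B₁ ∩ Ici n) + x (B₂ ∩ Ici n)‖ ≤ ‖x (A ∩ Ici n)‖ := by
      refine E.norm_le_of_abs_le ?_
      filter_upwards [E.coeFn_add (x (B₁ ∩ Ici n)) (x (B₂ ∩ Ici n)),
        E.coeFn_restr _ (hY (B₁ ∩ Ici n)) w,
        E.coeFn_restr _ (hY (B₂ ∩ Ici n)) w, E.coeFn_restr _ (hY (A ∩ Ici n)) w]
        with t h2 h4 h5 h6
      rw [h2, h4, h5, h6]
      by_cases ht : t ∈ Y (B₁ ∩ Ici n)
      · have ht1 : t ∈ Y (A ∩ Ici n) := hYmono (inter_subset_inter_left _ hB₁) ht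
        have ht2 : t ∉ Y (B₂ ∩ Ici n) := disjoint_left.1
          (hYdisj (hB.mono inter_subset_left inter_subset_left)) ht
        simp [ht, ht1, ht2]
      · by_cases ht2 : t ∈ Y (B₂ ∩ Ici n)
        · have ht1 : t ∈ Y (A ∩ Ici n) := hYmono (inter_subset_inter_left _ hB₂) ht2
          simp [ht, ht1, ht2]
        · simp [ht, ht2]
    have h3 := mul_le_mul_of_nonneg_left h2 (norm_nonneg (φ + ψ))
    have h4 : (φ + ψ) (x (B₁ ∩ Ici n) + x (B₂ ∩ Ici n)) = φ (x (B₁ ∩ Ici n))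
        + φ (x (B₂ ∩ Ici n)) + (ψ (x (B₁ ∩ Ici n)) + ψ (x (B₂ ∩ Ici n))) := by
      rw [add_apply, map_add, map_add]
    have h5 := (abs_le.1 (hφ2 n)).1
    have h6 := (abs_le.1 (hψ1 n)).1
    have h7 := hφB n
    have h8 := hψB n
    linarith
  have hfinal : 4 * c / (2 + ‖φ + ψ‖) ≤ c := le_ciInf hge
  rw [div_le_iff₀ (by positivity)] at hfinal
  nlinarith

/-- A Banach function space whose dual is strictly convex is order continuous. -/
theorem exists_norm_restr_lt [StrictConvexSpace ℝ (StrongDual ℝ E.Space)] (w : E.Space)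
    (hw : ∀ᵐ t ∂vol a b, 0 ≤ w.val t) (X : ℕ → Set ℝ) (hX : ∀ n, MeasurableSet (X n))
    (hanti : Antitone X) (hempty : ⋂ n, X n = ∅) {δ : ℝ} (hδ : 0 < δ) :
    ∃ n, ‖E.restr (X n) (hX n) w‖ < δ := by
  by_contra! hbig
  -- By the Fatou property a finite stage of `X n \ X m` already has norm above `δ / 2`; iterating
  -- gives disjoint pieces.
  have hstep := fun n => E.exists_lt_norm_restr_diff w hw X hX hanti hempty n
    ((half_lt_self hδ).trans_le (hbig n))
  choose next hgt hlt using hstep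
  let s : ℕ → ℕ := fun n => Nat.rec 0 (fun _ m => next m) n
  have hs : Monotone s := (strictMono_nat_of_lt_succ fun n => hgt (s n)).monotone
  obtain ⟨k, hk⟩ := E.norm_restr_biUnion_lt w hw (fun k => X (s k) \ X (s (k + 1)))
    (fun k => (hX _).diff (hX _)) (by
      have : ∀ i j, i < j → Disjoint (X (s i) \ X (s (i + 1))) (X (s j) \ X (s (j + 1))) := by
        intro i j hij
        rw [disjoint_left]
        intro t ht ht'
        exact ht.2 (hanti (hs hij) ht'.1)
      intro i j hij
      rcases lt_or_gt_of_ne hij with h | h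
      · exact this i j h
      · exact (this j i h).symm) (half_pos hδ)
  exact lt_asymm hk (hlt (s k))

theorem tendsto_norm_restr_uIcc [StrictConvexSpace ℝ (StrongDual ℝ E.Space)] (w : E.Space)
    (hw : ∀ᵐ t ∂vol a b, 0 ≤ w.val t) (z : ℝ) :
    Tendsto (fun x => ‖E.restr (uIcc z x) measurableSet_uIcc w‖) (𝓝 z) (𝓝 0) := by
  -- The centre is removed to make the intersection empty; it is a null set, so the norms do not
  -- notice.
  let X : ℕ → Set ℝ := fun n => Metric.ball z (1 / ((n : ℝ) + 1)) \ {z}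
  have hX : ∀ n, MeasurableSet (X n) := fun n => measurableSet_ball.diff (measurableSet_singleton z)
  have hanti : Antitone X := fun m n h =>
    sdiff_subset_sdiff_left (Metric.ball_subset_ball (one_div_le_one_div_of_le (by positivity)
      (by exact_mod_cast Nat.succ_le_succ h)))
  have hempty : ⋂ n, X n = ∅ := by
    refine eq_empty_of_forall_notMem fun t ht => ?_
    rw [mem_iInter] at ht
    obtain ⟨n, hn⟩ := exists_nat_one_div_lt (dist_pos.2 (ht 0).2)
    exact lt_asymm hn (ht n).1
  rw [Metric.tendsto_nhds]
  intro δ hδ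
  obtain ⟨n, hn⟩ := E.exists_norm_restr_lt w hw X hX hanti hempty hδ
  have hz : Metric.ball z (1 / ((n : ℝ) + 1)) ∈ 𝓝 z := Metric.ball_mem_nhds z (by positivity)
  filter_upwards [hz] with x hx
  rw [dist_zero_right, norm_norm]
  refine (E.norm_restr_mono_ae _ (hX n) ?_ w).trans_lt hn
  have hne : ∀ᵐ t ∂vol a b, t ≠ z := ae_restrict_of_ae (Measure.ae_ne volume z)
  filter_upwards [hne] with t ht htx
  refine ⟨?_, ht⟩
  rw [Metric.mem_ball] at hx ⊢
  refine lt_of_le_of_lt ?_ hx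
  rw [Real.dist_eq, Real.dist_eq]
  exact abs_sub_left_of_mem_uIcc htx

/-! ### Oscillation of the Hardy operator on an interval -/

theorem Space.val_toSpace {E : BFS a b} (f : L0 a b) (hf : E.nrm f < ∞) :
    (E.toSpace f hf).val = f := rfl

section Oscillation

variable (u v : L0 a b) (hu : E.assocNrm u < ∞) (hv : E.nrm v < ∞)

theorem coeFn_hardy (c : ℝ) (f : E.Space) : ∀ᵐ x ∂vol a b,
    (E.hardy c u v hu hv f).val x = v x * ∫ t in c..x, f.val t * u t ∂vol a b :=
  E.coeFn_hardyFun c u v hu f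

theorem hardyOn_cut (c x y : ℝ) (f : E.Space) :
    E.hardyOn c x y u v hu hv (E.cut x y f) = E.hardyOn c x y u v hu hv f := by
  refine Space.ext_ae ?_
  filter_upwards [E.coeFn_hardy _ _ (E.assocNrm_chi_mul_lt_top _ measurableSet_Ioo hu)
      (E.nrm_chi_mul_lt_top _ measurableSet_Ioo hv) c (E.cut x y f),
    E.coeFn_hardy _ _ (E.assocNrm_chi_mul_lt_top (Ioo x y) measurableSet_Ioo hu)
      (E.nrm_chi_mul_lt_top (Ioo x y) measurableSet_Ioo hv) c f] with t h1 h2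
  refine h1.trans (Eq.trans ?_ h2.symm)
  congr 1
  refine intervalIntegral.integral_congr_ae ?_
  filter_upwards [E.coeFn_cut x y f, coeFn_chi_mul (Ioo x y) measurableSet_Ioo u] with s h3 h4 _
  rw [h3, h4]
  by_cases hs : s ∈ Ioo x y <;> simp [hs]

/-- For `t` in `(x, y)` the primitives from `c` and from `a` differ by a constant. The constant is
split at `x` because `c` may lie outside the interval, where the cut integrand vanishes. -/
theorem hardyOn_eq_cut (c x y : ℝ) (f : E.Space) :
    E.hardyOn c x y u v hu hv f = E.cut x y (E.hardy a u v hu hv f -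
      ((∫ t in a..x, f.val t * u t ∂vol a b) +
        ∫ t in x..c, f.val t * (chi a b (Ioo x y) measurableSet_Ioo * u : L0 a b) t ∂vol a b) •
        E.toSpace v hv) := by
  set κ₁ := ∫ t in a..x, f.val t * u t ∂vol a b with hκ₁
  set κ₂ := ∫ t in x..c, f.val t * (chi a b (Ioo x y) measurableSet_Ioo * u : L0 a b) t ∂vol a b
    with hκ₂
  have hint := E.integrable_mul f hu
  have hint' := E.integrable_mul f (E.assocNrm_chi_mul_lt_top (Ioo x y) measurableSet_Ioo hu)
  refine Space.ext_ae ?_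
  filter_upwards [E.coeFn_hardy _ _ (E.assocNrm_chi_mul_lt_top (Ioo x y) measurableSet_Ioo hu)
      (E.nrm_chi_mul_lt_top (Ioo x y) measurableSet_Ioo hv) c f,
    coeFn_chi_mul (Ioo x y) measurableSet_Ioo v, E.coeFn_hardy u v hu hv a f,
    E.coeFn_cut x y (E.hardy a u v hu hv f - (κ₁ + κ₂) • E.toSpace v hv),
    E.coeFn_sub (E.hardy a u v hu hv f) ((κ₁ + κ₂) • E.toSpace v hv),
    E.coeFn_smul (κ₁ + κ₂) (E.toSpace v hv)] with t h1 h2 h3 h4 h5 h6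
  refine h1.trans ?_
  rw [h2, h4]
  by_cases ht : t ∈ Ioo x y
  swap
  · simp [ht]
  rw [indicator_of_mem ht, indicator_of_mem ht, h5, h6, h3, Space.val_toSpace]
  have e1 : ∫ s in x..t, f.val s * (chi a b (Ioo x y) measurableSet_Ioo * u : L0 a b) s ∂vol a b
      = ∫ s in x..t, f.val s * u s ∂vol a b := by
    refine intervalIntegral.integral_congr_ae ?_
    filter_upwards [coeFn_chi_mul (Ioo x y) measurableSet_Ioo u] with s hs hs'
    rw [uIoc_of_le ht.1.le] at hs'
    rw [hs, indicator_of_mem (show s ∈ Ioo x y from ⟨hs'.1, hs'.2.trans_lt ht.2⟩)]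
  have e2 := intervalIntegral.integral_add_adjacent_intervals
    (hint.intervalIntegrable (a := a) (b := x)) (hint.intervalIntegrable (a := x) (b := t))
  have e3 := intervalIntegral.integral_add_adjacent_intervals
    (hint'.intervalIntegrable (a := x) (b := c)) (hint'.intervalIntegrable (a := c) (b := t))
  rw [← e2, ← hκ₁]
  rw [e1, ← hκ₂] at e3
  rw [← e3]
  ring

/-- The distance on `(x, y)` of `T f` from the multiples of `v`. -/
noncomputable def hardyOsc (x y : ℝ) (f : E.Space) : ℝ :=
  ⨅ α : ℝ, ‖E.cut x y (E.hardy a u v hu hv f - α • E.toSpace v hv)‖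

theorem bddBelow_range_norm {ι : Sort*} (f : ι → E.Space) : BddBelow (range fun i => ‖f i‖) :=
  ⟨0, by rintro _ ⟨i, rfl⟩; exact norm_nonneg _⟩

theorem hardyOsc_nonneg (x y : ℝ) (f : E.Space) : 0 ≤ E.hardyOsc u v hu hv x y f :=
  le_ciInf fun _ => norm_nonneg _

theorem hardyOsc_le (x y : ℝ) (f : E.Space) (α : ℝ) : E.hardyOsc u v hu hv x y f ≤
    ‖E.cut x y (E.hardy a u v hu hv f - α • E.toSpace v hv)‖ :=
  ciInf_le (E.bddBelow_range_norm _) α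

theorem cut_cut (x y : ℝ) (f : E.Space) : E.cut x y (E.cut x y f) = E.cut x y f := by
  refine Space.ext_ae ?_
  filter_upwards [E.coeFn_cut x y (E.cut x y f), E.coeFn_cut x y f] with t h1 h2
  rw [h1]
  by_cases ht : t ∈ Ioo x y
  · simp [ht]
  · rw [h2]; simp [ht]

/-- The constant of integration is absorbed by translating `α`, so the base point disappears. -/
theorem iInf_hardyOn (c x y : ℝ) (f : E.Space) :
    ⨅ α : ℝ, ‖E.cut x y (E.hardyOn c x y u v hu hv f - α • E.toSpace v hv)‖ =
      E.hardyOsc u v hu hv x y f := by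
  rw [hardyOn_eq_cut]
  set κ := (∫ t in a..x, f.val t * u t ∂vol a b) +
    ∫ t in x..c, f.val t * (chi a b (Ioo x y) measurableSet_Ioo * u : L0 a b) t ∂vol a b
  refine Equiv.iInf_congr (Equiv.addRight κ) fun α => ?_
  congr 1
  simp only [Equiv.coe_addRight, cut_eq_restr, map_sub, map_smul]
  have h := E.cut_cut x y
  simp only [cut_eq_restr] at h
  rw [h, h]
  module

theorem hardyOsc_cut (x y : ℝ) (f : E.Space) :
    E.hardyOsc u v hu hv x y (E.cut x y f) = E.hardyOsc u v hu hv x y f := by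
  rw [← E.iInf_hardyOn u v hu hv a, hardyOn_cut, iInf_hardyOn]

theorem hardyOsc_le_norm (c x y : ℝ) (f : E.Space) :
    E.hardyOsc u v hu hv x y f ≤ ‖E.hardyOn c x y u v hu hv f‖ := by
  rw [hardyOn_eq_cut]
  exact E.hardyOsc_le u v hu hv x y f _

theorem hardyOsc_le_opNorm (c x y : ℝ) (f : E.Space) :
    E.hardyOsc u v hu hv x y f ≤ ‖E.hardyOn c x y u v hu hv‖ * ‖E.cut x y f‖ := by
  rw [← hardyOsc_cut]
  exact (E.hardyOsc_le_norm u v hu hv c x y _).trans (ContinuousLinearMap.le_opNorm _ _)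

theorem calA_eq (c x y : ℝ) : E.calA c x y u v hu hv =
    ⨆ f : {f : E.Space // E.cut x y f ≠ 0}, E.hardyOsc u v hu hv x y f.1 / ‖E.cut x y f.1‖ := by
  unfold calA
  refine iSup_congr fun f => ?_
  rw [← E.iInf_hardyOn u v hu hv c]
  simp only [div_eq_mul_inv]
  exact (Real.iInf_mul_of_nonneg (inv_nonneg.2 (norm_nonneg _)) _).symm

theorem hardyOsc_le_calA (c x y : ℝ) (f : E.Space) :
    E.hardyOsc u v hu hv x y f ≤ E.calA c x y u v hu hv * ‖E.cut x y f‖ := by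
  by_cases hf : E.cut x y f = 0
  · have := E.hardyOsc_le_opNorm u v hu hv c x y f
    rw [hf, norm_zero, mul_zero] at this ⊢
    exact this
  rw [← div_le_iff₀ (norm_pos_iff.2 hf), calA_eq]
  refine le_ciSup (f := fun f : {f : E.Space // E.cut x y f ≠ 0} =>
    E.hardyOsc u v hu hv x y f.1 / ‖E.cut x y f.1‖) ⟨‖E.hardyOn c x y u v hu hv‖, ?_⟩ ⟨f, hf⟩
  rintro _ ⟨g, rfl⟩
  exact div_le_of_le_mul₀ (norm_nonneg _) (norm_nonneg _) (E.hardyOsc_le_opNorm u v hu hv c x y g)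

theorem calA_le {c x y M : ℝ} (hM : 0 ≤ M)
    (h : ∀ f, E.hardyOsc u v hu hv x y f ≤ M * ‖E.cut x y f‖) :
    E.calA c x y u v hu hv ≤ M := by
  rw [calA_eq]
  exact Real.iSup_le (fun f => div_le_of_le_mul₀ (norm_nonneg _) hM (h f)) hM

theorem calA_nonneg (c x y : ℝ) : 0 ≤ E.calA c x y u v hu hv := by
  rw [calA_eq]
  exact Real.iSup_nonneg fun f => div_nonneg (E.hardyOsc_nonneg u v hu hv x y _) (norm_nonneg _)

theorem calA_eq_calA (c c' x y : ℝ) : E.calA c x y u v hu hv = E.calA c' x y u v hu hv :=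
  le_antisymm (E.calA_le u v hu hv (E.calA_nonneg u v hu hv _ _ _)
      (E.hardyOsc_le_calA u v hu hv c' x y))
    (E.calA_le u v hu hv (E.calA_nonneg u v hu hv _ _ _) (E.hardyOsc_le_calA u v hu hv c x y))

theorem calA_le_norm_hardyOn (c x y : ℝ) :
    E.calA c x y u v hu hv ≤ ‖E.hardyOn c x y u v hu hv‖ :=
  E.calA_le u v hu hv (norm_nonneg _) (E.hardyOsc_le_opNorm u v hu hv c x y)

theorem exists_lt_hardyOsc {c x y M : ℝ} (hM : 0 ≤ M) (h : M < E.calA c x y u v hu hv) :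
    ∃ f, E.cut x y f = f ∧ f ≠ 0 ∧ M * ‖f‖ < E.hardyOsc u v hu hv x y f := by
  by_contra! hcon
  refine h.not_ge (E.calA_le u v hu hv hM fun f => ?_)
  rw [← hardyOsc_cut]
  by_cases hf : E.cut x y f = 0
  · have := E.hardyOsc_le_opNorm u v hu hv c x y (E.cut x y f)
    rw [cut_cut] at this
    rw [hf, norm_zero, mul_zero] at this ⊢
    exact this
  · exact hcon _ (E.cut_cut x y f) hf

theorem cut_eq_zero {x y : ℝ} (h : y ≤ x) (f : E.Space) : E.cut x y f = 0 := by
  refine Space.ext_ae ?_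
  filter_upwards [E.coeFn_cut x y f, E.coeFn_zero] with t h1 h2
  rw [h1, h2, Ioo_eq_empty_of_le h, indicator_empty]

theorem calA_eq_zero {x y : ℝ} (h : y ≤ x) (c : ℝ) : E.calA c x y u v hu hv = 0 := by
  refine le_antisymm (E.calA_le u v hu hv le_rfl fun f => ?_) (E.calA_nonneg u v hu hv c x y)
  refine (E.hardyOsc_le u v hu hv x y f 0).trans_eq ?_
  rw [E.cut_eq_zero h, norm_zero, zero_mul]

/-! ### Dependence on the end points -/

theorem norm_restr_hardy_sub_le (s : Set ℝ) (hs : MeasurableSet s) (f : E.Space) {α : ℝ}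
    (hα : |α| ≤ ‖f‖ * (E.assocNrm u).toReal) :
    ‖E.restr s hs (E.hardy a u v hu hv f - α • E.toSpace v hv)‖ ≤
      2 * (‖f‖ * (E.assocNrm u).toReal) * ‖E.restr s hs (E.toSpace v hv)‖ := by
  set M := ‖f‖ * (E.assocNrm u).toReal
  have hM : 0 ≤ M := (abs_nonneg _).trans hα
  rw [← Real.norm_of_nonneg (mul_nonneg zero_le_two hM), ← norm_smul]
  refine E.norm_le_of_abs_le ?_
  filter_upwards [E.coeFn_restr s hs (E.hardy a u v hu hv f - α • E.toSpace v hv),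
    E.coeFn_sub (E.hardy a u v hu hv f) (α • E.toSpace v hv),
    E.coeFn_smul α (E.toSpace v hv), E.coeFn_hardy u v hu hv a f,
    E.coeFn_smul (2 * M) (E.restr s hs (E.toSpace v hv)),
    E.coeFn_restr s hs (E.toSpace v hv)] with t h1 h2 h3 h4 h5 h6
  rw [h1, h5, h6]
  by_cases ht : t ∈ s
  swap
  · simp [ht]
  rw [indicator_of_mem ht, indicator_of_mem ht, h2, h3, h4, Space.val_toSpace, mul_comm,
    ← sub_mul, abs_mul, abs_mul, abs_of_nonneg (mul_nonneg zero_le_two hM)]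
  refine mul_le_mul_of_nonneg_right ?_ (abs_nonneg _)
  refine (abs_sub _ _).trans ?_
  have := E.abs_primitive_le a t u hu f
  linarith

/-- The best multiple of `v` may be taken in the range of the primitive. -/
theorem exists_norm_cut_lt (x y : ℝ) (f : E.Space) {δ : ℝ} (hδ : 0 < δ) :
    ∃ α, |α| ≤ ‖f‖ * (E.assocNrm u).toReal ∧
      ‖E.cut x y (E.hardy a u v hu hv f - α • E.toSpace v hv)‖ <
        E.hardyOsc u v hu hv x y f + δ := by
  obtain ⟨β, hβ⟩ := exists_lt_of_ciInf_lt (lt_add_of_pos_right (E.hardyOsc u v hu hv x y f) hδ)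
  set M := ‖f‖ * (E.assocNrm u).toReal with hM
  have hM0 : 0 ≤ M := mul_nonneg (norm_nonneg _) ENNReal.toReal_nonneg
  -- The primitive takes values in `[-M, M]`, so clamping `β` to that interval cannot increase its
  -- pointwise distance from the primitive.
  have hα : |max (-M) (min M β)| ≤ M :=
    abs_le.2 ⟨le_max_left _ _, max_le (by linarith) (min_le_left _ _)⟩
  refine ⟨max (-M) (min M β), hα, lt_of_le_of_lt (E.norm_le_of_abs_le ?_) hβ⟩
  set α := max (-M) (min M β) with hα'
  filter_upwards [E.coeFn_cut x y (E.hardy a u v hu hv f - α • E.toSpace v hv),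
    E.coeFn_cut x y (E.hardy a u v hu hv f - β • E.toSpace v hv),
    E.coeFn_sub (E.hardy a u v hu hv f) (α • E.toSpace v hv),
    E.coeFn_sub (E.hardy a u v hu hv f) (β • E.toSpace v hv),
    E.coeFn_smul α (E.toSpace v hv), E.coeFn_smul β (E.toSpace v hv),
    E.coeFn_hardy u v hu hv a f] with t h1 h2 h3 h4 h5 h6 h7
  rw [h1, h2]
  by_cases ht : t ∈ Ioo x y
  swap
  · simp [ht]
  rw [indicator_of_mem ht, indicator_of_mem ht, h3, h4, h5, h6, h7, Space.val_toSpace, mul_comm,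
    ← sub_mul, ← sub_mul, abs_mul, abs_mul]
  refine mul_le_mul_of_nonneg_right ?_ (abs_nonneg _)
  have hF := abs_le.1 (E.abs_primitive_le a t u hu f)
  rw [← hM] at hF
  rw [hα']
  rcases le_total β (-M) with h | h
  · rw [min_eq_right (by linarith), max_eq_left h, abs_of_nonneg (by linarith),
      abs_of_nonneg (by linarith)]
    linarith
  · rcases le_total β M with h' | h'
    · rw [min_eq_right h', max_eq_right h]
    · rw [min_eq_left h', max_eq_right (by linarith), abs_of_nonpos (by linarith),
        abs_of_nonpos (by linarith)]
      linarith

/-- Use on the larger set a multiple of `v` that is nearly best on `(x, y)`. As the multiple may be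
bounded by the size of the primitive, the error on the added set is at most `2 ‖f‖ ‖u‖` times `v`.
With nothing added this is also monotonicity. -/
theorem calA_le_add (c x y x' y' : ℝ) :
    E.calA c x' y' u v hu hv ≤ E.calA c x y u v hu hv + 2 * (E.assocNrm u).toReal *
      ‖E.restr (Ioo x' y' \ Ioo x y) (measurableSet_Ioo.diff measurableSet_Ioo)
        (E.toSpace v hv)‖ := by
  set M := (E.assocNrm u).toReal
  set r := ‖E.restr (Ioo x' y' \ Ioo x y) (measurableSet_Ioo.diff measurableSet_Ioo)
        (E.toSpace v hv)‖
  have hA := E.calA_nonneg u v hu hv c x y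
  have hM : 0 ≤ M := ENNReal.toReal_nonneg
  have hr : 0 ≤ r := norm_nonneg _
  refine E.calA_le u v hu hv (by positivity) fun f => ?_
  rw [← hardyOsc_cut]
  set g := E.cut x' y' f
  refine le_of_forall_pos_le_add fun δ hδ => ?_
  obtain ⟨α, hα, hlt⟩ := E.exists_norm_cut_lt u v hu hv x y g hδ
  have h1 := E.hardyOsc_le u v hu hv x' y' g α
  have h2 := E.norm_le_restr_add (measurableSet_Ioo (a := x') (b := y'))
    (measurableSet_Ioo (a := x) (b := y)) (measurableSet_Ioo.diff measurableSet_Ioo)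
    (by rw [union_sdiff_self]; exact subset_union_right)
    (E.hardy a u v hu hv g - α • E.toSpace v hv)
  have h3 := E.norm_restr_hardy_sub_le u v hu hv (Ioo x' y' \ Ioo x y)
    (measurableSet_Ioo.diff measurableSet_Ioo) g hα
  have h4 := E.hardyOsc_le_calA u v hu hv c x y g
  have h5 := mul_le_mul_of_nonneg_left (E.norm_cut_le x y g) hA
  have h6 : 2 * (‖g‖ * M) * r = 2 * M * r * ‖g‖ := by ring
  rw [h6] at h3
  rw [cut_eq_restr] at h1 hlt
  rw [add_mul]
  linarith

theorem calA_mono {c x y x' y' : ℝ} (hx : x' ≤ x) (hy : y ≤ y') :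
    E.calA c x y u v hu hv ≤ E.calA c x' y' u v hu hv := by
  refine (E.calA_le_add u v hu hv c x' y' x y).trans_eq ?_
  have h : Ioo x y \ Ioo x' y' = ∅ := sdiff_eq_empty.2 (Ioo_subset_Ioo hx hy)
  have h0 : E.restr (Ioo x y \ Ioo x' y') (measurableSet_Ioo.diff measurableSet_Ioo)
      (E.toSpace v hv) = 0 := by
    refine Space.ext_ae ?_
    filter_upwards [E.coeFn_restr _ (measurableSet_Ioo.diff measurableSet_Ioo) (E.toSpace v hv),
      E.coeFn_zero] with t h1 h2
    rw [h1, h2, h, indicator_empty]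
  rw [h0, norm_zero, mul_zero, add_zero]

theorem Ioo_diff_Ioo_subset (x y x' y' : ℝ) : Ioo x' y' \ Ioo x y ⊆ uIcc x x' ∪ uIcc y y' := by
  rintro t ⟨ht, ht'⟩
  rw [mem_union, mem_uIcc, mem_uIcc]
  by_cases h : t ≤ x
  · exact Or.inl (Or.inr ⟨ht.1.le, h⟩)
  · exact Or.inr (Or.inl ⟨not_lt.1 fun h' => ht' ⟨not_le.1 h, h'⟩, ht.2.le⟩)

theorem continuous_calA [StrictConvexSpace ℝ (StrongDual ℝ E.Space)]
    (hv0 : ∀ᵐ x ∂vol a b, 0 < v x) (c : ℝ) :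
    Continuous fun z : ℝ × ℝ => E.calA c z.1 z.2 u v hu hv := by
  rw [continuous_iff_continuousAt]
  rintro ⟨x, y⟩
  set w := E.toSpace v hv
  have hw : ∀ᵐ t ∂vol a b, 0 ≤ w.val t := hv0.mono fun t ht => ht.le
  set M := (E.assocNrm u).toReal
  have hM : 0 ≤ M := ENNReal.toReal_nonneg
  have hkey : ∀ x y x' y', E.calA c x' y' u v hu hv ≤ E.calA c x y u v hu hv + 2 * M *
      (‖E.restr (uIcc x x') measurableSet_uIcc w‖ + ‖E.restr (uIcc y y') measurableSet_uIcc w‖) :=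
    fun x y x' y' => (E.calA_le_add u v hu hv c x y x' y').trans (by
      gcongr
      exact E.norm_le_restr_add _ _ _ (Ioo_diff_Ioo_subset x y x' y') w)
  have hlim : Tendsto (fun z : ℝ × ℝ => 2 * M * (‖E.restr (uIcc x z.1) measurableSet_uIcc w‖
      + ‖E.restr (uIcc y z.2) measurableSet_uIcc w‖)) (𝓝 (x, y)) (𝓝 0) := by
    have h1 := (E.tendsto_norm_restr_uIcc w hw x).comp
      (continuous_fst.tendsto (X := ℝ × ℝ) (x, y))
    have h2 := (E.tendsto_norm_restr_uIcc w hw y).comp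
      (continuous_snd.tendsto (X := ℝ × ℝ) (x, y))
    simpa using (h1.add h2).const_mul (2 * M)
  refine tendsto_iff_dist_tendsto_zero.2
    (squeeze_zero (fun _ => dist_nonneg) (fun z => ?_) hlim)
  rw [Real.dist_eq, abs_le]
  have h1 := hkey x y z.1 z.2
  have h2 := hkey z.1 z.2 x y
  simp only [uIcc_comm z.1 x, uIcc_comm z.2 y] at h2
  constructor <;> linarith

theorem hardyOn_initial (x : ℝ) (f : E.Space) :
    E.hardyOn a a x u v hu hv f = E.cut a x (E.hardy a u v hu hv f) := by
  rw [hardyOn_eq_cut, intervalIntegral.integral_same, intervalIntegral.integral_same, add_zero,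
    zero_smul, sub_zero]

theorem norm_hardyOn_initial_mono {x y : ℝ} (h : x ≤ y) :
    ‖E.hardyOn a a x u v hu hv‖ ≤ ‖E.hardyOn a a y u v hu hv‖ := by
  refine ContinuousLinearMap.opNorm_le_bound _ (norm_nonneg _) fun f => ?_
  refine le_trans ?_ (ContinuousLinearMap.le_opNorm _ f)
  rw [hardyOn_initial, hardyOn_initial]
  exact E.norm_restr_mono _ _ (Ioo_subset_Ioo_right h) _

theorem norm_hardyOn_initial_self : ‖E.hardyOn a a a u v hu hv‖ = 0 := by
  refine le_antisymm (ContinuousLinearMap.opNorm_le_bound _ le_rfl fun f => ?_) (norm_nonneg _)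
  rw [hardyOn_initial, E.cut_eq_zero le_rfl, norm_zero, zero_mul]

theorem continuous_norm_hardyOn_initial [StrictConvexSpace ℝ (StrongDual ℝ E.Space)]
    (hv0 : ∀ᵐ x ∂vol a b, 0 < v x) :
    Continuous fun x => ‖E.hardyOn a a x u v hu hv‖ := by
  rw [continuous_iff_continuousAt]
  intro x
  set w := E.toSpace v hv
  have hw : ∀ᵐ t ∂vol a b, 0 ≤ w.val t := hv0.mono fun t ht => ht.le
  set M := (E.assocNrm u).toReal
  have hM : 0 ≤ M := ENNReal.toReal_nonneg
  have hkey : ∀ x y, ‖E.hardyOn a a y u v hu hv‖ ≤ ‖E.hardyOn a a x u v hu hv‖ + 2 * M *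
      ‖E.restr (uIcc x y) measurableSet_uIcc w‖ := by
    intro x y
    refine ContinuousLinearMap.opNorm_le_bound _ (by positivity) fun f => ?_
    have h1 := (E.hardyOn a a x u v hu hv).le_opNorm f
    rw [hardyOn_initial] at h1 ⊢
    have h2 := E.norm_le_restr_add (measurableSet_Ioo (a := a) (b := y))
      (measurableSet_Ioo (a := a) (b := x)) (measurableSet_uIcc (a := x) (b := y)) (by
        intro t ht
        rw [mem_union, mem_uIcc]
        by_cases h : t < x
        · exact Or.inl ⟨ht.1, h⟩
        · exact Or.inr (Or.inl ⟨not_lt.1 h, ht.2.le⟩)) (E.hardy a u v hu hv f)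
    have h3 := E.norm_restr_hardy_sub_le u v hu hv (uIcc x y) measurableSet_uIcc f (α := 0)
      (by rw [abs_zero]; positivity)
    rw [zero_smul, sub_zero] at h3
    have h4 : 2 * (‖f‖ * M) * ‖E.restr (uIcc x y) measurableSet_uIcc w‖
        = 2 * M * ‖E.restr (uIcc x y) measurableSet_uIcc w‖ * ‖f‖ := by ring
    rw [h4] at h3
    rw [cut_eq_restr] at h1 ⊢
    rw [add_mul]
    linarith
  have hlim := (E.tendsto_norm_restr_uIcc w hw x).const_mul (2 * M)
  rw [mul_zero] at hlim
  refine tendsto_iff_dist_tendsto_zero.2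
    (squeeze_zero (fun _ => dist_nonneg) (fun z => ?_) hlim)
  rw [Real.dist_eq, abs_le]
  have h1 := hkey x z
  have h2 := hkey z x
  simp only [uIcc_comm z x] at h2
  constructor <;> linarith

end Oscillation

/-! ### Positivity -/

theorem cut_ne_zero {x y : ℝ} (hx : a ≤ x) (hxy : x < y) (hy : y ≤ b) {f : E.Space}
    (hf : ∀ᵐ t ∂vol a b, 0 < f.val t) : E.cut x y f ≠ 0 := by
  intro h
  have h0 : vol a b (Ioo x y) = 0 := by
    have : ∀ᵐ t ∂vol a b, t ∉ Ioo x y := by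
      filter_upwards [E.coeFn_cut x y f, E.coeFn_zero, hf] with t h1 h2 h3 ht
      rw [h, h2, indicator_of_mem ht] at h1
      exact h3.ne h1
    rw [ae_iff] at this
    simp only [not_not] at this
    exact this
  rw [Measure.restrict_apply measurableSet_Ioo,
    inter_eq_left.2 (Ioo_subset_Ioo hx hy), Real.volume_Ioo] at h0
  have := ENNReal.ofReal_eq_zero.1 h0
  linarith

theorem exists_val_ae_eq_one : ∃ f : E.Space, ∀ᵐ t ∂vol a b, f.val t = 1 := by
  have h : (AEEqFun.mk (fun _ : ℝ => (1 : ℝ)) aestronglyMeasurable_const : L0 a b) =ᵐ[vol a b]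
    fun _ => 1 := AEEqFun.coeFn_mk _ _
  refine ⟨E.toSpace (AEEqFun.mk (fun _ : ℝ => (1 : ℝ)) aestronglyMeasurable_const)
    (E.nrm_lt_top_of_memLp_top _ ?_), h⟩
  exact (memLp_congr_ae h).2 (memLp_top_const 1)

section Positivity

variable (u v : L0 a b) (hu : E.assocNrm u < ∞) (hv : E.nrm v < ∞)

/-- Test with `f = 1`: its primitive `F` is strictly larger at `r` than at `s`. Any constant `α` is
on one side of the midpoint of `F s` and `F r`, hence at distance at least `d` from `F` on all of
`(x, s)` or all of `(r, y)`. -/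
theorem calA_pos (hu0 : ∀ᵐ x ∂vol a b, 0 < u x) (hv0 : ∀ᵐ x ∂vol a b, 0 < v x) (c : ℝ) {x y : ℝ}
    (hx : a ≤ x) (hxy : x < y) (hy : y ≤ b) : 0 < E.calA c x y u v hu hv := by
  obtain ⟨f, hf⟩ := E.exists_val_ae_eq_one
  set w := E.toSpace v hv with hw
  obtain ⟨s, hxs, hsy⟩ := exists_between hxy
  obtain ⟨r, hsr, hry⟩ := exists_between hsy
  have hint := E.integrable_mul f hu
  have hpos : ∀ᵐ t ∂vol a b, 0 < f.val t * u t := by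
    filter_upwards [hf, hu0] with t h1 h2
    rw [h1, one_mul]; exact h2
  set F : ℝ → ℝ := fun t => ∫ s in a..t, f.val s * u s ∂vol a b with hF
  have hFsub : ∀ p q, F q - F p = ∫ s in p..q, f.val s * u s ∂vol a b := fun p q =>
    intervalIntegral.integral_interval_sub_left hint.intervalIntegrable hint.intervalIntegrable
  have hmono : Monotone F := fun p q hpq => by
    rw [← sub_nonneg, hFsub]
    exact intervalIntegral.integral_nonneg_of_ae hpq (hpos.mono fun t ht => ht.le)
  have hlt : F s < F r := by
    refine lt_of_le_of_ne (hmono hsr.le) fun h => ?_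
    have h0 : ∫ t in Ioc s r, f.val t * u t ∂vol a b = 0 := by
      rw [← intervalIntegral.integral_of_le hsr.le, ← hFsub, h, sub_self]
    rw [integral_eq_zero_iff_of_nonneg_ae
      (ae_restrict_of_ae (hpos.mono fun t ht => ht.le)) hint.integrableOn] at h0
    have hfalse : ∀ᵐ t ∂(vol a b).restrict (Ioc s r), False := by
      filter_upwards [h0, ae_restrict_of_ae hpos] with t h1 h2
      exact h2.ne' h1
    have hzero : (vol a b).restrict (Ioc s r) = 0 :=
      ae_eq_bot.1 (eventually_false_iff_eq_bot.1 hfalse)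
    rw [Measure.restrict_eq_zero, Measure.restrict_apply measurableSet_Ioc, inter_eq_left.2
      (show Ioc s r ⊆ Ioo a b from fun t ht => ⟨by linarith [ht.1], by linarith [ht.2]⟩),
      Real.volume_Ioc] at hzero
    have := ENNReal.ofReal_eq_zero.1 hzero
    linarith
  set d := (F r - F s) / 2 with hd
  have hdpos : 0 < d := by rw [hd]; linarith
  set l := min ‖E.cut x s w‖ ‖E.cut r y w‖ with hl
  have hlpos : 0 < l := lt_min
    (norm_pos_iff.2 (E.cut_ne_zero hx hxs (by linarith) hv0))
    (norm_pos_iff.2 (E.cut_ne_zero (by linarith) hry hy hv0))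
  have hlow : ∀ (p q α : ℝ), x ≤ p → q ≤ y → (∀ t ∈ Ioo p q, d ≤ |F t - α|) →
      d * ‖E.cut p q w‖ ≤ ‖E.cut x y (E.hardy a u v hu hv f - α • w)‖ := by
    intro p q α hp hq h
    have e : d * ‖E.cut p q w‖ = ‖d • E.cut p q w‖ := by
      rw [norm_smul, Real.norm_of_nonneg hdpos.le]
    rw [e]
    refine E.norm_le_of_abs_le ?_
    filter_upwards [E.coeFn_cut x y (E.hardy a u v hu hv f - α • w),
      E.coeFn_sub (E.hardy a u v hu hv f) (α • w), E.coeFn_smul α w,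
      E.coeFn_hardy u v hu hv a f, E.coeFn_smul d (E.cut p q w), E.coeFn_cut p q w]
      with t h1 h2 h3 h4 h5 h6
    rw [h5, h6, h1]
    by_cases ht : t ∈ Ioo p q
    swap
    · simp [ht]
    rw [indicator_of_mem ht, indicator_of_mem (Ioo_subset_Ioo hp hq ht), h2, h3, h4, hw,
      Space.val_toSpace, mul_comm (v t), ← sub_mul, abs_mul, abs_mul, abs_of_pos hdpos]
    exact mul_le_mul_of_nonneg_right (h t ht) (abs_nonneg _)
  have hosc : d * l ≤ E.hardyOsc u v hu hv x y f := by
    refine le_ciInf fun α => ?_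
    rcases le_total α ((F r + F s) / 2) with hα | hα
    · refine (mul_le_mul_of_nonneg_left (min_le_right _ _) hdpos.le).trans
        (hlow r y α (by linarith) le_rfl fun t ht => ?_)
      have := hmono ht.1.le
      exact le_trans (by rw [hd]; linarith) (le_abs_self _)
    · refine (mul_le_mul_of_nonneg_left (min_le_left _ _) hdpos.le).trans
        (hlow x s α le_rfl (by linarith) fun t ht => ?_)
      have := hmono ht.2.le
      exact le_trans (by rw [hd]; linarith) (neg_le_abs _)
  have h1 := hosc.trans (E.hardyOsc_le_calA u v hu hv c x y f)
  by_contra! h2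
  have h3 := mul_nonpos_of_nonpos_of_nonneg h2 (norm_nonneg (E.cut x y f))
  have h4 := mul_pos hdpos hlpos
  linarith

theorem norm_hardyOn_initial_pos (hu0 : ∀ᵐ x ∂vol a b, 0 < u x) (hv0 : ∀ᵐ x ∂vol a b, 0 < v x)
    {x : ℝ} (hx : a < x) (hxb : x ≤ b) : 0 < ‖E.hardyOn a a x u v hu hv‖ :=
  (E.calA_pos u v hu hv hu0 hv0 a le_rfl hx hxb).trans_le (E.calA_le_norm_hardyOn u v hu hv a a x)

end Positivity

/-! ### Equalizing partitions -/

/-- A partition into `k + 1` intervals on which a monotone continuous interval function (with a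
separate function `h` for the initial interval) takes the same value. -/
theorem exists_equal_partition {a b : ℝ} (h : ℝ → ℝ) (A : ℝ → ℝ → ℝ) (hc : Continuous h)
    (hm : Monotone h) (ha : h a = 0) (hpos : ∀ x, a < x → x ≤ b → 0 < h x)
    (hAc : Continuous fun z : ℝ × ℝ => A z.1 z.2)
    (hAm : ∀ x y x' y', x' ≤ x → y ≤ y' → A x y ≤ A x' y') (hA0 : ∀ x, A x x = 0)
    (hApos : ∀ x y, a ≤ x → x < y → y ≤ b → 0 < A x y) (k : ℕ) :
    ∃ e : ℝ → ℝ, Continuous e ∧ Monotone e ∧ e a = 0 ∧ (∀ x, a < x → x ≤ b → 0 < e x) ∧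
      ∀ x, a < x → x ≤ b → ∃ p : ℕ → ℝ, p 0 = a ∧ p (k + 1) = x ∧
        (∀ i < k + 1, p i < p (i + 1)) ∧ h (p 1) = e x ∧
        ∀ i, 1 ≤ i → i ≤ k → A (p i) (p (i + 1)) = e x := by
  induction k with
  | zero =>
    refine ⟨h, hc, hm, ha, hpos, fun x hx _ => ⟨fun i => if i = 0 then a else x, ?_⟩⟩
    refine ⟨by simp, by simp, fun i hi => ?_, by simp, fun i h1 h2 => by omega⟩
    obtain rfl : i = 0 := by omega
    simpa using hx
  | succ k ih =>
    obtain ⟨e, hec, hem, hea, hepos, hep⟩ := ih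
    by_cases hab : a < b
    swap
    · exact ⟨e, hec, hem, hea, hepos, fun x hx hxb => absurd (hx.trans_le hxb) hab⟩
    -- Inductively, `e y` is the common value for `(a, y)`. With last division point `y`, balancing
    -- `e y`, which increases in `y`, against `A y x`, which decreases, amounts to minimizing their
    -- maximum.
    let g : ℝ → ℝ → ℝ := fun x y => max (e y) (A y x)
    have hgc : Continuous (Function.uncurry g) :=
      (hec.comp continuous_snd).max (hAc.comp (continuous_snd.prodMk continuous_fst))
    have hne : (Icc a b).Nonempty := ⟨a, le_rfl, hab.le⟩
    -- The infimum runs over all of `[a, b]`, not `[a, x]`: over a fixed compact set it is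
    -- continuous in `x`, and by monotonicity no point can beat the crossing point.
    let e' : ℝ → ℝ := fun x => sInf (g x '' Icc a b)
    have hbdd : ∀ x, BddBelow (g x '' Icc a b) := fun x =>
      (isCompact_Icc.image (hgc.comp (by fun_prop : Continuous fun y => (x, y)))).bddBelow
    have hroot : ∀ x, a < x → x ≤ b → ∃ y, a < y ∧ y < x ∧ e y = A y x ∧ e' x = e y := by
      intro x hx hxb
      have hcont : Continuous fun y => e y - A y x :=
        hec.sub (hAc.comp (continuous_id.prodMk continuous_const))
      have hiv := intermediate_value_Icc hx.le hcont.continuousOn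
      have h1 := hApos a x le_rfl hx hxb
      have h2 := hepos x hx hxb
      obtain ⟨y, hy, hy0⟩ := hiv (show (0 : ℝ) ∈ Icc (e a - A a x) (e x - A x x) from
        ⟨by rw [hea]; linarith, by rw [hA0]; linarith⟩)
      have hy0' : e y = A y x := sub_eq_zero.1 hy0
      have hay : a < y := by
        refine lt_of_le_of_ne hy.1 fun hay => ?_
        rw [← hay, hea] at hy0'
        linarith
      have hyx : y < x := by
        refine lt_of_le_of_ne hy.2 fun hyx => ?_
        rw [hyx, hA0] at hy0'
        linarith
      refine ⟨y, hay, hyx, hy0', le_antisymm ?_ ?_⟩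
      · refine csInf_le (hbdd x) ⟨y, ⟨hy.1, hy.2.trans hxb⟩, ?_⟩
        show max (e y) (A y x) = e y
        rw [← hy0', max_self]
      · refine le_csInf (hne.image _) ?_
        rintro _ ⟨z, hz, rfl⟩
        rcases le_total y z with hyz | hyz
        · exact (hem hyz).trans (le_max_left _ _)
        · rw [hy0']
          exact (hAm _ _ _ _ hyz le_rfl).trans (le_max_right _ _)
    refine ⟨e', isCompact_Icc.continuous_sInf hgc, fun x y hxy => ?_, ?_, fun x hx hxb => ?_,
      fun x hx hxb => ?_⟩
    · refine le_csInf (hne.image _) ?_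
      rintro _ ⟨z, hz, rfl⟩
      exact (csInf_le (hbdd x) ⟨z, hz, rfl⟩).trans (max_le_max le_rfl (hAm _ _ _ _ le_rfl hxy))
    · refine le_antisymm ((csInf_le (hbdd a) ⟨a, ⟨le_rfl, hab.le⟩, rfl⟩).trans_eq ?_) ?_
      · show max (e a) (A a a) = 0
        rw [hea, hA0, max_self]
      · refine le_csInf (hne.image _) ?_
        rintro _ ⟨z, hz, rfl⟩
        refine le_trans ?_ (le_max_left _ _)
        rw [← hea]
        exact hem hz.1
    · obtain ⟨y, hay, hyx, -, hy⟩ := hroot x hx hxb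
      rw [hy]
      exact hepos y hay (hyx.le.trans hxb)
    · obtain ⟨y, hay, hyx, hyA, hy⟩ := hroot x hx hxb
      obtain ⟨p, hp0, hpk, hplt, hp1, hpA⟩ := hep y hay (hyx.le.trans hxb)
      have hle : ∀ i, i ≤ k + 1 → (fun i => if i ≤ k + 1 then p i else x) i = p i :=
        fun i hi => if_pos hi
      have hgt : (fun i => if i ≤ k + 1 then p i else x) (k + 1 + 1) = x := if_neg (by omega)
      refine ⟨fun i => if i ≤ k + 1 then p i else x, ?_, hgt, fun i hi => ?_, ?_,
        fun i h1 h2 => ?_⟩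
      · rw [hle 0 (by omega), hp0]
      · rcases Nat.lt_succ_iff_lt_or_eq.1 hi with hi' | rfl
        · rw [hle i hi'.le, hle (i + 1) hi']
          exact hplt i hi'
        · rw [hle _ le_rfl, hgt, hpk]
          exact hyx
      · rw [hle 1 (by omega), hp1, hy]
      · rcases Nat.lt_succ_iff_lt_or_eq.1 (Nat.lt_succ_of_le h2) with hi' | rfl
        · rw [hle i hi'.le, hle (i + 1) hi', hpA i h1 (by omega), hy]
        · rw [hle _ le_rfl, hgt, hpk, ← hyA, hy]

/-! ### The condition (min) on finite partitions -/

theorem lt_of_forall_lt_succ {p : ℕ → ℝ} {N : ℕ} (hp : ∀ i < N, p i < p (i + 1)) {i j : ℕ}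
    (hij : i < j) (hj : j ≤ N) : p i < p j := by
  induction j, hij using Nat.le_induction with
  | base => exact hp i (by omega)
  | succ j _ ih => exact (ih (by omega)).trans (hp j (by omega))

theorem le_of_forall_lt_succ {p : ℕ → ℝ} {N : ℕ} (hp : ∀ i < N, p i < p (i + 1)) {i j : ℕ}
    (hij : i ≤ j) (hj : j ≤ N) : p i ≤ p j := by
  rcases hij.eq_or_lt with rfl | h
  · exact le_rfl
  · exact (lt_of_forall_lt_succ hp h hj).le

theorem disjoint_Ioo_of_forall_lt_succ {p : ℕ → ℝ} {N : ℕ} (hp : ∀ i < N, p i < p (i + 1))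
    {i j : ℕ} (hi : i < N) (hj : j < N) (hij : i ≠ j) :
    Disjoint (Ioo (p i) (p (i + 1))) (Ioo (p j) (p (j + 1))) := by
  have key : ∀ {i j : ℕ}, i < j → j < N →
      Disjoint (Ioo (p i) (p (i + 1))) (Ioo (p j) (p (j + 1))) := by
    intro i j hij hj
    rw [disjoint_left]
    intro t ht ht'
    have := le_of_forall_lt_succ hp (Nat.succ_le_of_lt hij) hj.le
    exact absurd (ht.2.trans_le this) (not_lt.2 ht'.1.le)
  rcases lt_or_gt_of_ne hij with h | h
  · exact key h hj
  · exact (key h hi).symm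

/-- The partition of `(a, b)` given by finitely many points. -/
def finitePartition {a b : ℝ} (N : ℕ) (p : ℕ → ℝ) (h0 : p 0 = a) (hN : p N = b)
    (hp : ∀ i < N, p i < p (i + 1)) : IntervalPartition a b where
  parts := (fun i => (p i, p (i + 1))) '' Iio N
  countable := ((finite_Iio N).image _).countable
  lt := by rintro _ ⟨i, hi, rfl⟩; exact hp i hi
  subset := by
    rintro _ ⟨i, hi, rfl⟩
    rw [← h0, ← hN]
    exact Ioo_subset_Ioo (le_of_forall_lt_succ hp (Nat.zero_le i) (le_of_lt hi))
      (le_of_forall_lt_succ hp hi le_rfl)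
  disjoint := by
    rintro _ ⟨i, hi, rfl⟩ _ ⟨j, hj, rfl⟩ hne
    exact disjoint_Ioo_of_forall_lt_succ hp hi hj fun h => hne (by rw [h])
  cover := by
    refine measure_mono_null ?_ (((finite_Iic N).image p).measure_zero volume)
    rintro t ⟨ht, ht'⟩
    have hex : ∃ j, t ≤ p j := ⟨N, by rw [hN]; exact ht.2.le⟩
    classical
    have hjN : Nat.find hex ≤ N := Nat.find_min' hex (by rw [hN]; exact ht.2.le)
    refine ⟨Nat.find hex, hjN, ?_⟩
    -- Take the first division point not below `t`; if it were not `t` itself, `t` would lie in the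
    -- interval ending there.
    refine le_antisymm (not_lt.1 fun hlt => ht' ?_) (Nat.find_spec hex)
    obtain ⟨i, hi⟩ : ∃ i, Nat.find hex = i + 1 := by
      refine Nat.exists_eq_succ_of_ne_zero fun h => ?_
      have := Nat.find_spec hex
      rw [h, h0] at this
      exact absurd ht.1 (not_lt.2 this)
    have hi' : ¬ t ≤ p i := Nat.find_min hex (by omega)
    rw [hi] at hlt
    refine mem_iUnion₂.2 ⟨(p i, p (i + 1)), ⟨i, ?_, rfl⟩, not_le.1 hi', hlt⟩
    rw [mem_Iio]
    omega

theorem chi_ne_zero {x y : ℝ} (hx : a ≤ x) (hxy : x < y) (hy : y ≤ b) :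
    E.nrm (chi a b (Ioo x y) measurableSet_Ioo) ≠ 0 := by
  intro h
  obtain ⟨f, hf⟩ := E.exists_val_ae_eq_one
  refine E.cut_ne_zero hx hxy hy (f := f) (hf.mono fun t ht => by rw [ht]; exact one_pos) ?_
  refine Space.ext_ae ?_
  filter_upwards [E.coeFn_zero, AEEqFun.coeFn_mul (chi a b (Ioo x y) measurableSet_Ioo) f.val,
    AEEqFun.coeFn_zero (μ := vol a b) (α := ℝ) (β := ℝ)] with t h1 h2 h3
  rw [h1]
  refine h2.trans ?_
  rw [Pi.mul_apply, (E.nrm_eq_zero_iff _).1 h, h3, Pi.zero_apply, zero_mul]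

/-- The two step functions have the same steps, so the estimate is a pointwise comparison of
coefficients. -/
theorem nrm_avg_le {N : ℕ} {p : ℕ → ℝ} (h0 : p 0 = a) (hN : p N = b)
    (hp : ∀ i < N, p i < p (i + 1)) {M : ℝ} (hM : 0 ≤ M) (f g : E.Space)
    (h : ∀ i < N, ‖E.cut (p i) (p (i + 1)) g‖ ≤ M * ‖E.cut (p i) (p (i + 1)) f‖) :
    E.nrm (E.avg (finitePartition N p h0 hN hp) g.val) ≤
      ENNReal.ofReal M * E.nrm (E.avg (finitePartition N p h0 hN hp) f.val) := by
  set Q := finitePartition N p h0 hN hp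
  have hfin : Finite Q.parts := ((finite_Iio N).image _).to_subtype
  have hfin' := Fintype.ofFinite Q.parts
  rw [← Real.enorm_eq_ofReal hM, ← E.nrm_smul]
  refine E.nrm_le_of_abs_le ?_
  have hmk : ∀ f : L0 a b, ∀ᵐ x ∂vol a b, E.avg Q f x =
      (∑' p : Q.parts, (Ioo p.1.1 p.1.2).indicator
      (fun _ => E.nrm (chi a b (Ioo p.1.1 p.1.2) measurableSet_Ioo * f) /
        E.nrm (chi a b (Ioo p.1.1 p.1.2) measurableSet_Ioo)) x).toReal :=
    fun f => AEEqFun.coeFn_mk _ _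
  filter_upwards [hmk f.val, hmk g.val, AEEqFun.coeFn_smul M (E.avg Q f.val)] with t h1 h2 h3
  rw [h3, Pi.smul_apply, h1, h2, smul_eq_mul, abs_of_nonneg ENNReal.toReal_nonneg,
    abs_of_nonneg (mul_nonneg hM ENNReal.toReal_nonneg), ← ENNReal.toReal_ofReal hM,
    ← ENNReal.toReal_mul, ← ENNReal.tsum_mul_left]
  refine ENNReal.toReal_mono ?_ (ENNReal.tsum_le_tsum ?_)
  -- Finiteness of the larger sum is essential, as `toReal` sends `∞` to `0`; it holds because there
  -- are finitely many intervals, all with `χ` of nonzero norm.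
  · rw [tsum_fintype]
    refine ENNReal.sum_ne_top.2 fun q _ => ENNReal.mul_ne_top ENNReal.ofReal_ne_top ?_
    by_cases ht : t ∈ Ioo q.1.1 q.1.2
    · rw [indicator_of_mem ht]
      obtain ⟨⟨_, _⟩, i, hi, heq⟩ := q
      cases heq
      refine ENNReal.div_ne_top (E.nrm_chi_mul_lt_top _ _ f.nrm_lt_top).ne
        (E.chi_ne_zero ?_ (hp i hi) ?_)
      · exact h0.symm.le.trans (le_of_forall_lt_succ hp (Nat.zero_le i) (le_of_lt hi))
      · exact (le_of_forall_lt_succ hp hi le_rfl).trans hN.le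
    · rw [indicator_of_notMem ht]; exact ENNReal.zero_ne_top
  · rintro ⟨⟨_, _⟩, i, hi, heq⟩
    cases heq
    by_cases ht : t ∈ Ioo (p i) (p (i + 1))
    · simp only [indicator_of_mem ht]
      rw [← mul_div_assoc]
      refine ENNReal.div_le_div_right ?_ _
      have hi' := ENNReal.ofReal_le_ofReal (h i hi)
      rw [ENNReal.ofReal_mul hM] at hi'
      rwa [norm_def, norm_def, ENNReal.ofReal_toReal (Space.nrm_lt_top _).ne,
        ENNReal.ofReal_toReal (Space.nrm_lt_top _).ne] at hi'
    · simp only [indicator_of_notMem ht]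
      simp

/-- Under `(min)`, local norm estimates on a partition give a global one. -/
theorem SatisfiesMin.exists_norm_le {E : BFS a b} (hmin : E.SatisfiesMin) :
    ∃ K : ℝ, 0 < K ∧ ∀ (N : ℕ) (p : ℕ → ℝ), p 0 = a → p N = b → (∀ i < N, p i < p (i + 1)) →
      ∀ (M : ℝ), 0 ≤ M → ∀ f g : E.Space,
        (∀ i < N, ‖E.cut (p i) (p (i + 1)) g‖ ≤ M * ‖E.cut (p i) (p (i + 1)) f‖) →
        ‖g‖ ≤ K * M * ‖f‖ := by
  obtain ⟨C, hC, hmin⟩ := hmin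
  refine ⟨C * C, by positivity, fun N p h0 hN hp M hM f g h => ?_⟩
  set Q := finitePartition N p h0 hN hp
  have key : E.nrm g.val ≤ C * (ENNReal.ofReal M * (C * E.nrm f.val)) :=
    (hmin Q g.val g.nrm_lt_top).1.trans (by
      gcongr
      refine (E.nrm_avg_le h0 hN hp hM f g h).trans ?_
      gcongr
      exact (hmin Q f.val f.nrm_lt_top).2)
  have hfin : (C : ℝ≥0∞) * (ENNReal.ofReal M * (C * E.nrm f.val)) ≠ ∞ :=
    ENNReal.mul_ne_top ENNReal.coe_ne_top (ENNReal.mul_ne_top ENNReal.ofReal_ne_top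
      (ENNReal.mul_ne_top ENNReal.coe_ne_top f.nrm_lt_top.ne))
  refine (ENNReal.toReal_mono hfin key).trans_eq ?_
  rw [ENNReal.toReal_mul, ENNReal.toReal_mul, ENNReal.toReal_mul, ENNReal.toReal_ofReal hM,
    ENNReal.coe_toReal, norm_def]
  ring

/-! ### Approximation and isomorphism numbers -/

/-- A functional of norm at most one that vanishes on a line and is large at a point far from it. -/
theorem exists_dual_of_le_norm_sub {X : Type*} [NormedAddCommGroup X] [NormedSpace ℝ X]
    {g w : X} {r : ℝ} (hr : 0 < r) (h : ∀ α : ℝ, r ≤ ‖g - α • w‖) :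
    ∃ φ : StrongDual ℝ X, ‖φ‖ ≤ 1 ∧ φ w = 0 ∧ r ≤ φ g := by
  -- The ball of radius `r` is separated from the affine line `g - ℝ w`; a functional bounded below
  -- on that line must vanish on `w`.
  obtain ⟨φ, s, hφ, hs⟩ := geometric_hahn_banach_open (convex_ball (0 : X) r) Metric.isOpen_ball
    (t := {x | ∃ α : ℝ, x = g - α • w}) (by
      rintro _ ⟨α, rfl⟩ _ ⟨β, rfl⟩ c d _ _ hcd
      refine ⟨c * α + d * β, ?_⟩
      obtain rfl : d = 1 - c := by linarith
      module) (by
      rw [Set.disjoint_left]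
      rintro _ hx ⟨α, rfl⟩
      rw [mem_ball_zero_iff] at hx
      exact absurd (h α) (not_le.2 hx))
  have hs0 : 0 < s := by simpa using hφ 0 (Metric.mem_ball_self hr)
  have hnorm : ‖φ‖ * r ≤ s := norm_mul_le_of_ball hr hφ
  have hline : ∀ α : ℝ, s ≤ φ g - α * φ w := fun α => by
    have := hs _ ⟨α, rfl⟩
    rwa [map_sub, map_smul, smul_eq_mul] at this
  have hg : s ≤ φ g := by simpa using hline 0
  have hw : φ w = 0 := by
    by_contra hw
    have := hline ((φ g - s + 1) / φ w)
    rw [div_mul_cancel₀ _ hw] at this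
    linarith
  have hφ0 : 0 < ‖φ‖ := by
    refine norm_pos_iff.2 fun h => ?_
    rw [h] at hg
    simp at hg
    linarith
  refine ⟨‖φ‖⁻¹ • φ, ?_, ?_, ?_⟩
  · rw [norm_smul, norm_inv, norm_norm, inv_mul_cancel₀ hφ0.ne']
  · show ‖φ‖⁻¹ * φ w = 0
    rw [hw, mul_zero]
  · show r ≤ ‖φ‖⁻¹ * φ g
    rw [inv_mul_eq_div, le_div_iff₀ hφ0, mul_comm]
    exact hnorm.trans hg

theorem approxNumber_le {X : Type} [NormedAddCommGroup X] [NormedSpace ℝ X] {n : ℕ}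
    {S P : X →L[ℝ] X} (hP : LinearMap.rank (P : X →ₗ[ℝ] X) < n) : approxNumber n S ≤ ‖S - P‖ :=
  csInf_le ⟨0, by rintro _ ⟨P, _, rfl⟩; exact norm_nonneg _⟩ ⟨P, hP, rfl⟩

/-- `P ∘ B` has rank below the dimension of `G`, so it kills some `x ≠ 0`; then `x = A (S - P) B x`,
which bounds `‖x‖`. -/
theorem inv_norm_mul_inv_norm_le {X : Type} [NormedAddCommGroup X] [NormedSpace ℝ X] {n : ℕ}
    {S P : X →L[ℝ] X} (hP : LinearMap.rank (P : X →ₗ[ℝ] X) < n)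
    {G : Type} [NormedAddCommGroup G] [NormedSpace ℝ G] {A : X →L[ℝ] G} {B : G →L[ℝ] X}
    (hG : (n : Cardinal) ≤ Module.rank ℝ G)
    (hAB : A ∘L S ∘L B = ContinuousLinearMap.id ℝ G) : ‖A‖⁻¹ * ‖B‖⁻¹ ≤ ‖S - P‖ := by
  obtain ⟨x, hx0, hx⟩ : ∃ x : G, x ≠ 0 ∧ P (B x) = 0 := by
    by_contra! hcon
    have hinj : Function.Injective ((P : X →ₗ[ℝ] X) ∘ₗ (B : G →ₗ[ℝ] X)) := by
      rw [← LinearMap.ker_eq_bot, LinearMap.ker_eq_bot']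
      intro x hx
      by_contra hx0
      exact hcon x hx0 hx
    have h1 := rank_range_of_injective _ hinj
    have h2 := LinearMap.rank_comp_le_left (B : G →ₗ[ℝ] X) (P : X →ₗ[ℝ] X)
    rw [LinearMap.rank, h1] at h2
    exact absurd (hG.trans h2) (not_le.2 hP)
  have hxe : x = A ((S - P) (B x)) := by
    have := DFunLike.congr_fun hAB x
    simp only [ContinuousLinearMap.comp_apply, ContinuousLinearMap.id_apply] at this
    rw [sub_apply, hx, sub_zero, this]
  have hle : ‖x‖ ≤ ‖A‖ * (‖S - P‖ * (‖B‖ * ‖x‖)) := by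
    conv_lhs => rw [hxe]
    exact (A.le_opNorm _).trans (mul_le_mul_of_nonneg_left (((S - P).le_opNorm _).trans
      (mul_le_mul_of_nonneg_left (B.le_opNorm _) (norm_nonneg _))) (norm_nonneg _))
  have hxpos := norm_pos_iff.2 hx0
  have h1 : 1 ≤ ‖A‖ * ‖B‖ * ‖S - P‖ := by
    refine le_of_mul_le_mul_right ?_ hxpos
    linarith
  have hAB0 : 0 < ‖A‖ * ‖B‖ := by
    rcases (mul_nonneg (norm_nonneg A) (norm_nonneg B)).eq_or_lt with h | h
    · rw [← h, zero_mul] at h1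
      linarith
    · exact h
  rw [← mul_inv, inv_le_iff_one_le_mul₀ hAB0]
  linarith

theorem rank_zero_lt {X : Type} [NormedAddCommGroup X] [NormedSpace ℝ X] {n : ℕ} (hn : 0 < n) :
    LinearMap.rank ((0 : X →L[ℝ] X) : X →ₗ[ℝ] X) < n := by
  have : LinearMap.rank (0 : X →ₗ[ℝ] X) < n := by
    rw [LinearMap.rank_zero]
    exact_mod_cast hn
  exact this

theorem le_isoNumber {X : Type} [NormedAddCommGroup X] [NormedSpace ℝ X] {n : ℕ} (hn : 0 < n)
    {S : X →L[ℝ] X} {G : Type} [NormedAddCommGroup G] [NormedSpace ℝ G] [CompleteSpace G]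
    {A : X →L[ℝ] G} {B : G →L[ℝ] X} (hG : (n : Cardinal) ≤ Module.rank ℝ G)
    (hAB : A ∘L S ∘L B = ContinuousLinearMap.id ℝ G) : ‖A‖⁻¹ * ‖B‖⁻¹ ≤ isoNumber n S := by
  -- Boundedness must be checked, since the supremum of an unbounded set of reals is `0` by
  -- convention; comparison with `P = 0` provides it.
  refine le_csSup ⟨‖S - 0‖, ?_⟩ ⟨G, _, _, inferInstance, A, B, hG, hAB, rfl⟩
  rintro _ ⟨G, _, _, _, A, B, hG, hAB, rfl⟩
  exact inv_norm_mul_inv_norm_le (rank_zero_lt hn) hG hAB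

theorem isoNumber_le_approxNumber {X : Type} [NormedAddCommGroup X] [NormedSpace ℝ X] {n : ℕ}
    (hn : 0 < n) (S : X →L[ℝ] X) : isoNumber n S ≤ approxNumber n S := by
  refine le_csInf ⟨_, 0, rank_zero_lt hn, rfl⟩ ?_
  rintro _ ⟨P, hP, rfl⟩
  -- Covers the case of no factorization too, where the supremum of the empty set is `0`.
  refine Real.sSup_le ?_ (norm_nonneg _)
  rintro _ ⟨G, _, _, _, A, B, hG, hAB, rfl⟩
  exact inv_norm_mul_inv_norm_le hP hG hAB

theorem cut_cut_of_disjoint {x y x' y' : ℝ} (h : Disjoint (Ioo x y) (Ioo x' y')) (f : E.Space) :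
    E.cut x y (E.cut x' y' f) = 0 := by
  refine Space.ext_ae ?_
  filter_upwards [E.coeFn_cut x y (E.cut x' y' f), E.coeFn_cut x' y' f, E.coeFn_zero]
    with t h1 h2 h3
  rw [h1, h3]
  by_cases ht : t ∈ Ioo x y
  · rw [indicator_of_mem ht, h2, indicator_of_notMem (disjoint_left.1 h ht)]
  · rw [indicator_of_notMem ht]

section Numbers

variable (u v : L0 a b) (hu : E.assocNrm u < ∞) (hv : E.nrm v < ∞)

/-- Where `f` vanishes its primitive is constant. So a functional that kills `v` on an interval does
not see functions supported off it. -/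
theorem exists_cut_hardy_eq_smul {x y : ℝ} {f : E.Space} (hf : E.cut x y f = 0) :
    ∃ κ : ℝ, E.cut x y (E.hardy a u v hu hv f) = κ • E.cut x y (E.toSpace v hv) := by
  have h := E.hardyOn_eq_cut u v hu hv a x y f
  rw [← hardyOn_cut, hf, map_zero] at h
  simp only [cut_eq_restr, map_sub, map_smul] at h ⊢
  exact ⟨_, sub_eq_zero.1 h.symm⟩

theorem norm_cut_hardy_initial_le (x : ℝ) (f : E.Space) :
    ‖E.cut a x (E.hardy a u v hu hv f)‖ ≤ ‖E.hardyOn a a x u v hu hv‖ * ‖E.cut a x f‖ := by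
  rw [← hardyOn_initial, ← hardyOn_cut]
  exact ContinuousLinearMap.le_opNorm _ _

/-- A linear choice of nearly best multiples of `v`. -/
theorem exists_dual_norm_cut_sub_le {x y : ℝ} (hw : E.cut x y (E.toSpace v hv) ≠ 0) :
    ∃ ω : StrongDual ℝ E.Space, ∀ f, ‖E.cut x y (E.hardy a u v hu hv f) -
      ω (E.cut x y (E.hardy a u v hu hv f)) • E.cut x y (E.toSpace v hv)‖ ≤
        2 * E.hardyOsc u v hu hv x y f := by
  set w := E.cut x y (E.toSpace v hv) with hw'
  obtain ⟨φ, hφ, hφw⟩ := exists_dual_vector ℝ w (norm_ne_zero_iff.2 hw)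
  have hwpos := norm_pos_iff.2 hw
  have hφw' : φ w = ‖w‖ := hφw
  refine ⟨‖w‖⁻¹ • φ, fun f => ?_⟩
  set g := E.cut x y (E.hardy a u v hu hv f) with hg
  rw [hardyOsc, Real.mul_iInf_of_nonneg zero_le_two]
  refine le_ciInf fun α => ?_
  have e1 : E.cut x y (E.hardy a u v hu hv f - α • E.toSpace v hv) = g - α • w := by
    simp only [hg, hw', cut_eq_restr, map_sub, map_smul]
  -- `φ` norms `w`, so this is a projection onto the line of `w` with norm one. Its complement has
  -- norm at most two and does not change when a multiple of `w` is subtracted, whence the factor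
  -- `2`.
  have e2 : g - (‖w‖⁻¹ • φ) g • w = (g - α • w) - (‖w‖⁻¹ * φ (g - α • w)) • w := by
    have : (‖w‖⁻¹ • φ) g = ‖w‖⁻¹ * φ g := rfl
    rw [this, map_sub, map_smul, hφw', smul_eq_mul, mul_sub, mul_left_comm,
      inv_mul_cancel₀ hwpos.ne']
    module
  rw [e1, e2, two_mul]
  refine (norm_sub_le _ _).trans (add_le_add le_rfl ?_)
  rw [norm_smul, norm_mul, norm_inv, norm_norm, mul_right_comm, inv_mul_cancel₀ hwpos.ne', one_mul]
  have := φ.le_opNorm (g - α • w)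
  rwa [hφ, one_mul] at this

theorem approxNumber_hardy_le {K : ℝ}
    (hv0 : ∀ᵐ x ∂vol a b, 0 < v x) {N : ℕ} (hN : 0 < N) {p : ℕ → ℝ} (hp0 : p 0 = a) (hpN : p N = b)
    (hp : ∀ i < N, p i < p (i + 1))
    (hK : ∀ (M : ℝ), 0 ≤ M → ∀ f g : E.Space,
        (∀ i < N, ‖E.cut (p i) (p (i + 1)) g‖ ≤ M * ‖E.cut (p i) (p (i + 1)) f‖) →
        ‖g‖ ≤ K * M * ‖f‖) {ε : ℝ} (hε : 0 < ε) (hK0 : 0 < K)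
    (h1 : ‖E.hardyOn a a (p 1) u v hu hv‖ ≤ ε)
    (h2 : ∀ i, 1 ≤ i → i < N → E.calA a (p i) (p (i + 1)) u v hu hv ≤ ε) :
    approxNumber N (E.hardy a u v hu hv) ≤ 2 * K * ε := by
  set T := E.hardy a u v hu hv with hT
  have hap : ∀ i ≤ N, a ≤ p i := fun i hi => hp0 ▸ le_of_forall_lt_succ hp (Nat.zero_le i) hi
  have hpb : ∀ i ≤ N, p i ≤ b := fun i hi => hpN ▸ le_of_forall_lt_succ hp hi le_rfl
  have hω : ∀ i, ∃ ω : StrongDual ℝ E.Space, i < N → ∀ f, ‖E.cut (p i) (p (i + 1)) (T f) -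
      ω (E.cut (p i) (p (i + 1)) (T f)) • E.cut (p i) (p (i + 1)) (E.toSpace v hv)‖ ≤
        2 * E.hardyOsc u v hu hv (p i) (p (i + 1)) f := by
    intro i
    by_cases hi : i < N
    · obtain ⟨ω, h⟩ := E.exists_dual_norm_cut_sub_le u v hu hv
        (E.cut_ne_zero (f := E.toSpace v hv) (hap i hi.le) (hp i hi) (hpb _ hi) hv0)
      exact ⟨ω, fun _ => h⟩
    · exact ⟨0, fun h => absurd h hi⟩
  choose ω hω using hω
  let R : ℕ → E.Space →L[ℝ] E.Space := fun i => E.restr (Ioo (p i) (p (i + 1))) measurableSet_Ioo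
  let w : ℕ → E.Space := fun i => R i (E.toSpace v hv)
  -- The sum starts at `1`: on the initial interval `T f` is already small by `h1`, and this saves
  -- the one dimension that the strict rank bound requires.
  let P : E.Space →L[ℝ] E.Space :=
    ∑ i ∈ Finset.Ico 1 N, ((ω i) ∘L (R i) ∘L T).smulRight (w i)
  have hPapp : ∀ f, P f = ∑ i ∈ Finset.Ico 1 N, ω i (R i (T f)) • w i := fun f => by
    simp [P]
  have hrank : LinearMap.rank (P : E.Space →ₗ[ℝ] E.Space) < N := by
    classical
    have hsub : LinearMap.range (P : E.Space →ₗ[ℝ] E.Space) ≤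
        Submodule.span ℝ (((Finset.Ico 1 N).image w : Finset E.Space) : Set E.Space) := by
      rintro _ ⟨f, rfl⟩
      show P f ∈ _
      rw [hPapp]
      exact Submodule.sum_mem _ fun i hi => Submodule.smul_mem _ _
        (Submodule.subset_span (Finset.mem_coe.2 (Finset.mem_image_of_mem w hi)))
    refine ((Submodule.rank_mono hsub).trans (rank_span_finset_le _)).trans_lt ?_
    have hcard := Finset.card_image_le (s := Finset.Ico 1 N) (f := w)
    rw [Nat.card_Ico] at hcard
    exact_mod_cast lt_of_le_of_lt hcard (by omega)
  refine (approxNumber_le hrank).trans (ContinuousLinearMap.opNorm_le_bound _ (by positivity) ?_)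
  intro f
  refine (hK (2 * ε) (by positivity) f _ fun i hi => ?_).trans_eq (by ring)
  have hRw : ∀ j ∈ Finset.Ico 1 N, j ≠ i → R i (w j) = 0 := fun j hj hji =>
    E.cut_cut_of_disjoint (disjoint_Ioo_of_forall_lt_succ hp hi (Finset.mem_Ico.1 hj).2 hji.symm) _
  have hcut : E.cut (p i) (p (i + 1)) ((T - P) f) =
      R i (T f) - ∑ j ∈ Finset.Ico 1 N, ω j (R j (T f)) • R i (w j) := by
    show R i ((T - P) f) = _
    rw [sub_apply, map_sub, hPapp, map_sum]
    simp only [map_smul]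
  rw [hcut]
  rcases Nat.eq_zero_or_pos i with rfl | hi0
  · rw [Finset.sum_eq_zero, sub_zero]
    · have h3 := E.norm_cut_hardy_initial_le u v hu hv (p 1) f
      have h4 : R 0 (T f) = E.cut a (p 1) (T f) := by
        rw [cut_eq_restr]; simp only [R, hp0, zero_add]
      have h5 : E.cut (p 0) (p (0 + 1)) f = E.cut a (p 1) f := by rw [hp0]
      rw [h4, h5]
      refine h3.trans (mul_le_mul_of_nonneg_right (h1.trans (by linarith)) (norm_nonneg _))
    · intro j hj
      rw [hRw j hj (by have := (Finset.mem_Ico.1 hj).1; omega), smul_zero]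
  · have hmem : i ∈ Finset.Ico 1 N := Finset.mem_Ico.2 ⟨hi0, hi⟩
    rw [Finset.sum_eq_single_of_mem i hmem fun j hj hji => by rw [hRw j hj hji, smul_zero]]
    have h3 : R i (w i) = E.cut (p i) (p (i + 1)) (E.toSpace v hv) := E.cut_cut _ _ _
    rw [h3]
    refine (hω i hi f).trans ?_
    have h4 := E.hardyOsc_le_calA u v hu hv a (p i) (p (i + 1)) f
    have h5 := mul_le_mul_of_nonneg_right (h2 i hi0 hi)
      (norm_nonneg (E.cut (p i) (p (i + 1)) f))
    linarith

/-- A nearly extremal function on one interval of the partition, with a functional that detects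
it and does not see the constants of integration coming from the other intervals. -/
theorem exists_extremal {x y r : ℝ} (hr : 0 < r)
    (h : (x = a ∧ r < ‖E.hardyOn a a y u v hu hv‖) ∨ r < E.calA a x y u v hu hv) :
    ∃ (f : E.Space) (φ : StrongDual ℝ E.Space), f ≠ 0 ∧ E.cut x y f = f ∧ ‖φ‖ ≤ 1 ∧
      r * ‖f‖ ≤ φ (E.cut x y (E.hardy a u v hu hv f)) ∧
      ∀ g, E.cut x y g = 0 → φ (E.cut x y (E.hardy a u v hu hv g)) = 0 := by
  rcases h with ⟨rfl, h⟩ | h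
  · obtain ⟨f, hf0, hf⟩ : ∃ f : E.Space, f ≠ 0 ∧ r * ‖f‖ < ‖E.hardyOn x x y u v hu hv f‖ := by
      by_contra! hcon
      refine h.not_ge (ContinuousLinearMap.opNorm_le_bound _ hr.le fun f => ?_)
      by_cases hf : f = 0
      · rw [hf, map_zero, norm_zero, mul_zero]
      · exact hcon f hf
    have hlt : r * ‖E.cut x y f‖ < ‖E.cut x y (E.hardy x u v hu hv (E.cut x y f))‖ := by
      rw [← hardyOn_initial, hardyOn_cut]
      exact (mul_le_mul_of_nonneg_left (E.norm_cut_le x y f) hr.le).trans_lt hf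
    set f' := E.cut x y f with hf'
    have hf'0 : f' ≠ 0 := by
      intro h0
      rw [← hardyOn_initial, h0, map_zero, norm_zero, mul_zero] at hlt
      exact lt_irrefl _ hlt
    -- No line has to be killed on the initial interval: there is no constant of integration from
    -- further left, so an ordinary norming functional suffices.
    obtain ⟨φ, hφ, -, hφf⟩ := exists_dual_of_le_norm_sub (w := (0 : E.Space))
      (mul_pos hr (norm_pos_iff.2 hf'0)) (fun α => by rw [smul_zero, sub_zero]; exact hlt.le)
    refine ⟨f', φ, hf'0, E.cut_cut _ _ _, hφ, hφf, fun g hg => ?_⟩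
    have := E.norm_cut_hardy_initial_le u v hu hv y g
    rw [hg, norm_zero, mul_zero] at this
    rw [norm_le_zero_iff.1 this, map_zero]
  · obtain ⟨f, hff, hf0, hf⟩ := E.exists_lt_hardyOsc u v hu hv hr.le h
    obtain ⟨φ, hφ, hφw, hφf⟩ := exists_dual_of_le_norm_sub
      (g := E.cut x y (E.hardy a u v hu hv f)) (w := E.cut x y (E.toSpace v hv))
      (mul_pos hr (norm_pos_iff.2 hf0)) (fun α => by
        refine hf.le.trans ((E.hardyOsc_le u v hu hv x y f α).trans_eq ?_)
        simp only [cut_eq_restr, map_sub, map_smul])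
    refine ⟨f, φ, hf0, hff, hφ, hφf, fun g hg => ?_⟩
    obtain ⟨κ, hκ⟩ := E.exists_cut_hardy_eq_smul u v hu hv hg
    rw [hκ, map_smul, hφw, smul_zero]

/-- `G` is the span of the `N` extremal functions, `B` its inclusion, and `A` reads off each
coefficient with the functional of its interval. On each interval `A` has norm at most `1 / r`, so
by (min) at most `K / r` globally. -/
theorem le_isoNumber_hardy {K : ℝ} {N : ℕ} (hN : 0 < N) {p : ℕ → ℝ} (hp0 : p 0 = a)
    (hp : ∀ i < N, p i < p (i + 1))
    (hK : ∀ (M : ℝ), 0 ≤ M → ∀ f g : E.Space,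
        (∀ i < N, ‖E.cut (p i) (p (i + 1)) g‖ ≤ M * ‖E.cut (p i) (p (i + 1)) f‖) →
        ‖g‖ ≤ K * M * ‖f‖) {r : ℝ} (hr : 0 < r) (hK0 : 0 < K)
    (h1 : r < ‖E.hardyOn a a (p 1) u v hu hv‖)
    (h2 : ∀ i, 1 ≤ i → i < N → r < E.calA a (p i) (p (i + 1)) u v hu hv) :
    r / K ≤ isoNumber N (E.hardy a u v hu hv) := by
  set T := E.hardy a u v hu hv with hT
  have hex : ∀ i : Fin N, ∃ (f : E.Space) (φ : StrongDual ℝ E.Space), f ≠ 0 ∧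
      E.cut (p i) (p (i + 1)) f = f ∧ ‖φ‖ ≤ 1 ∧
      r * ‖f‖ ≤ φ (E.cut (p i) (p (i + 1)) (T f)) ∧
      ∀ g, E.cut (p i) (p (i + 1)) g = 0 → φ (E.cut (p i) (p (i + 1)) (T g)) = 0 := by
    rintro ⟨i, hi⟩
    refine E.exists_extremal u v hu hv hr ?_
    rcases Nat.eq_zero_or_pos i with rfl | hi0
    · exact Or.inl ⟨hp0, by simpa using h1⟩
    · exact Or.inr (h2 i hi0 hi)
  choose f φ hf0 hff hφ hφf hφg using hex
  let R : Fin N → E.Space →L[ℝ] E.Space :=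
    fun i => E.restr (Ioo (p i) (p (i + 1))) measurableSet_Ioo
  have hRf : ∀ i j, R i (f j) = if i = j then f i else 0 := by
    intro i j
    split_ifs with hij
    · rw [← hij]; exact hff i
    · rw [← hff j]
      exact E.cut_cut_of_disjoint
        (disjoint_Ioo_of_forall_lt_succ hp i.2 j.2 fun h => hij (Fin.ext h)) _
  have hpos : ∀ i, 0 < φ i (R i (T (f i))) := fun i =>
    (mul_pos hr (norm_pos_iff.2 (hf0 i))).trans_le (hφf i)
  let A₀ : E.Space →L[ℝ] E.Space :=
    ∑ i, ((φ i (R i (T (f i))))⁻¹ • ((φ i) ∘L (R i))).smulRight (f i)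
  have hA₀ : ∀ g, A₀ g = ∑ i, ((φ i (R i (T (f i))))⁻¹ * φ i (R i g)) • f i := fun g => by
    simp [A₀]
  have hA₀f : ∀ j, A₀ (T (f j)) = f j := by
    intro j
    rw [hA₀, Finset.sum_eq_single j]
    · rw [inv_mul_cancel₀ (hpos j).ne', one_smul]
    · intro i _ hij
      have : φ i (R i (T (f j))) = 0 := hφg i (f j) (by
        have := hRf i j
        rwa [if_neg hij] at this)
      rw [this, mul_zero, zero_smul]
    · intro h; exact absurd (Finset.mem_univ j) h
  have hRA : ∀ i g, R i (A₀ g) = ((φ i (R i (T (f i))))⁻¹ * φ i (R i g)) • f i := by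
    intro i g
    rw [hA₀, map_sum, Finset.sum_eq_single i]
    · rw [map_smul, hRf, if_pos rfl]
    · intro j _ hji
      rw [map_smul, hRf, if_neg hji.symm, smul_zero]
    · intro h; exact absurd (Finset.mem_univ i) h
  have hA₀norm : ∀ g, ‖A₀ g‖ ≤ K * r⁻¹ * ‖g‖ := by
    intro g
    refine hK r⁻¹ (inv_nonneg.2 hr.le) g _ fun i hi => ?_
    have h3 : E.cut (p i) (p (i + 1)) (A₀ g) = _ := hRA ⟨i, hi⟩ g
    rw [h3, norm_smul, norm_mul, norm_inv, Real.norm_of_nonneg (hpos _).le]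
    have h4 : ‖φ ⟨i, hi⟩ (R ⟨i, hi⟩ g)‖ ≤ ‖E.cut (p i) (p (i + 1)) g‖ :=
      ((φ ⟨i, hi⟩).le_opNorm _).trans (mul_le_of_le_one_left (norm_nonneg _) (hφ _))
    have h5 := hφf ⟨i, hi⟩
    have h6 := hpos ⟨i, hi⟩
    rw [mul_assoc, inv_mul_eq_div, inv_mul_eq_div, div_le_div_iff₀ h6 hr]
    calc ‖φ ⟨i, hi⟩ (R ⟨i, hi⟩ g)‖ * ‖f ⟨i, hi⟩‖ * r
        = ‖φ ⟨i, hi⟩ (R ⟨i, hi⟩ g)‖ * (r * ‖f ⟨i, hi⟩‖) := by ring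
      _ ≤ _ := mul_le_mul h4 h5 (by positivity) (norm_nonneg _)
  let G : Submodule ℝ E.Space := Submodule.span ℝ (range f)
  have hfG : ∀ i, f i ∈ G := fun i => Submodule.subset_span (mem_range_self i)
  have hlin : LinearIndependent ℝ f := by
    rw [Fintype.linearIndependent_iff]
    intro c hc i
    have := congrArg (R i) hc
    rw [map_sum, map_zero, Finset.sum_eq_single i] at this
    · rw [map_smul, hRf, if_pos rfl] at this
      exact (smul_eq_zero.1 this).resolve_right (hf0 i)
    · intro j _ hji
      rw [map_smul, hRf, if_neg hji.symm, smul_zero]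
    · intro h; exact absurd (Finset.mem_univ i) h
  have hrank : (N : Cardinal) ≤ Module.rank ℝ G := by
    rw [rank_span hlin, Cardinal.mk_range_eq f hlin.injective, Cardinal.mk_fin]
  have : FiniteDimensional ℝ G := FiniteDimensional.span_of_finite ℝ (finite_range f)
  have : CompleteSpace G := FiniteDimensional.complete ℝ G
  have hA₀G : ∀ g, A₀ g ∈ G := fun g => by
    rw [hA₀]
    exact Submodule.sum_mem _ fun i _ => Submodule.smul_mem _ _ (hfG i)
  let A : E.Space →L[ℝ] G := A₀.codRestrict G hA₀G
  let B : G →L[ℝ] E.Space := G.subtypeL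
  have hid : A ∘L T ∘L B = ContinuousLinearMap.id ℝ G := by
    ext ⟨g, hg⟩
    show A₀ (T g) = g
    induction hg using Submodule.span_induction with
    | mem x hx => obtain ⟨i, rfl⟩ := hx; exact hA₀f i
    | zero => rw [map_zero, map_zero]
    | add x y _ _ hx hy => rw [map_add, map_add, hx, hy]
    | smul c x _ hx => rw [map_smul, map_smul, hx]
  refine le_trans ?_ (le_isoNumber hN hrank hid)
  have hAn : ‖A‖ ≤ K * r⁻¹ := ContinuousLinearMap.opNorm_le_bound _ (by positivity) hA₀norm
  have hBn : ‖B‖ ≤ 1 := G.norm_subtypeL_le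
  -- Needed since the inverse of zero is zero: the upper bounds on the norms give a lower bound on
  -- the inverses only for nonzero norms.
  have hA0 : 0 < ‖A‖ := by
    refine (norm_nonneg A).lt_of_ne' fun h => ?_
    have h3 : ‖f ⟨0, hN⟩‖ ≤ ‖A‖ * ‖T (f ⟨0, hN⟩)‖ := by
      conv_lhs => rw [← hA₀f ⟨0, hN⟩]
      exact A.le_opNorm _
    rw [h, zero_mul] at h3
    exact hf0 ⟨0, hN⟩ (norm_le_zero_iff.1 h3)
  have hB0 : 0 < ‖B‖ := by
    refine (norm_nonneg B).lt_of_ne' fun h => ?_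
    have h3 := B.le_opNorm ⟨f ⟨0, hN⟩, hfG _⟩
    rw [h, zero_mul] at h3
    exact hf0 ⟨0, hN⟩ (norm_le_zero_iff.1 h3)
  rw [← mul_inv, ← inv_div]
  refine inv_anti₀ (mul_pos hA0 hB0) ?_
  rw [div_eq_mul_inv]
  exact (mul_le_of_le_one_right hA0.le hBn).trans hAn

end Numbers

end BFS

end HardyBFS

/-! ### The two-sided estimates -/

theorem mainTheorem3 {a b : ℝ} (hab : a < b) (E : HardyBFS.BFS a b)
    [StrictConvexSpace ℝ E.Space]
    [StrictConvexSpace ℝ (StrongDual ℝ E.Space)]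
    (hmin : E.SatisfiesMin)
    (hAC : HardyBFS.HasACNorm E.assocNrm) :
    ∃ C₁ C₂ : ℝ, 0 < C₁ ∧ 0 < C₂ ∧
      ∀ (u v : HardyBFS.L0 a b) (hu : E.assocNrm u < ∞) (hv : E.nrm v < ∞),
        (∀ᵐ x ∂HardyBFS.vol a b, 0 < u x) → (∀ᵐ x ∂HardyBFS.vol a b, 0 < v x) →
        ∀ N : ℕ, 1 < N →
          ∃ (ε : ℝ) (p : ℕ → ℝ), 0 < ε ∧
            (p 0 = a ∧ p N = b ∧ ∀ i < N, p i < p (i + 1)) ∧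
            (∀ i, 2 ≤ i → i ≤ N → ∀ c ∈ Icc a b, E.calA c (p (i - 1)) (p i) u v hu hv = ε) ∧
            ‖E.hardyOn a a (p 1) u v hu hv‖ = ε ∧
            (C₁ * ε ≤ HardyBFS.approxNumber N (E.hardy a u v hu hv) ∧
              HardyBFS.approxNumber N (E.hardy a u v hu hv) ≤ C₂ * ε) ∧
            (C₁ * ε ≤ HardyBFS.isoNumber N (E.hardy a u v hu hv) ∧
              HardyBFS.isoNumber N (E.hardy a u v hu hv) ≤ C₂ * ε) ∧
            (C₁ * HardyBFS.isoNumber N (E.hardy a u v hu hv)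
                ≤ HardyBFS.approxNumber N (E.hardy a u v hu hv) ∧
              HardyBFS.approxNumber N (E.hardy a u v hu hv)
                ≤ C₂ * HardyBFS.isoNumber N (E.hardy a u v hu hv)) := by
  obtain ⟨K, hK0, hK⟩ := hmin.exists_norm_le
  -- With `a_N ≤ 2 K ε` and `ε ≤ 2 K i_N` one gets `a_N ≤ 4 K² i_N`; the sum serves both upper
  -- bounds. The `1` in the minimum serves `C₁ i_N ≤ a_N`.
  refine ⟨min 1 (1 / (2 * K)), 2 * K + 4 * K * K, by positivity, by positivity, ?_⟩
  intro u v hu hv hu0 hv0 N hN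
  obtain ⟨k, rfl⟩ : ∃ k, N = k + 1 := ⟨N - 1, by omega⟩
  obtain ⟨e, -, -, -, hepos, hep⟩ := HardyBFS.BFS.exists_equal_partition (a := a) (b := b)
    (fun x => ‖E.hardyOn a a x u v hu hv‖) (fun x y => E.calA a x y u v hu hv)
    (E.continuous_norm_hardyOn_initial u v hu hv hv0)
    (fun x y h => E.norm_hardyOn_initial_mono u v hu hv h)
    (E.norm_hardyOn_initial_self u v hu hv)
    (fun x hx hxb => E.norm_hardyOn_initial_pos u v hu hv hu0 hv0 hx hxb)
    (E.continuous_calA u v hu hv hv0 a)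
    (fun x y x' y' hx hy => E.calA_mono u v hu hv hx hy)
    (fun x => E.calA_eq_zero u v hu hv le_rfl a)
    (fun x y hx hxy hy => E.calA_pos u v hu hv hu0 hv0 a hx hxy hy) k
  obtain ⟨p, hp0, hpN, hp, hp1, hpA⟩ := hep b hab le_rfl
  have hε := hepos b hab le_rfl
  set ε := e b
  have hKp := hK (k + 1) p hp0 hpN hp
  have hA : HardyBFS.approxNumber (k + 1) (E.hardy a u v hu hv) ≤ 2 * K * ε :=
    E.approxNumber_hardy_le u v hu hv hv0 k.succ_pos hp0 hpN hp hKp hε hK0 hp1.le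
      fun i h1 h2 => (hpA i h1 (by omega)).le
  -- The extremal functions exist only strictly below the common value; `ε / 2` is a convenient
  -- choice.
  have hI : ε / 2 / K ≤ HardyBFS.isoNumber (k + 1) (E.hardy a u v hu hv) :=
    E.le_isoNumber_hardy u v hu hv k.succ_pos hp0 hp hKp (half_pos hε) hK0
      ((half_lt_self hε).trans_eq hp1.symm)
      fun i h1 h2 => (half_lt_self hε).trans_eq (hpA i h1 (by omega)).symm
  have hIA := HardyBFS.BFS.isoNumber_le_approxNumber k.succ_pos (E.hardy a u v hu hv)
  set α := HardyBFS.approxNumber (k + 1) (E.hardy a u v hu hv)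
  set ι := HardyBFS.isoNumber (k + 1) (E.hardy a u v hu hv)
  have hlow : min 1 (1 / (2 * K)) * ε ≤ ι := by
    refine (mul_le_mul_of_nonneg_right (min_le_right _ _) hε.le).trans (le_of_eq_of_le ?_ hI)
    field_simp
  have hup : α ≤ (2 * K + 4 * K * K) * ε := hA.trans
    (mul_le_mul_of_nonneg_right (by nlinarith) hε.le)
  have hι : 0 ≤ ι := le_trans (by positivity) hI
  refine ⟨ε, p, hε, ⟨hp0, hpN, hp⟩, fun i hi2 hiN c _ => ?_, hp1, ⟨hlow.trans hIA, hup⟩,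
    ⟨hlow, hIA.trans hup⟩, ?_, ?_⟩
  · obtain ⟨j, rfl⟩ : ∃ j, i = j + 1 := ⟨i - 1, by omega⟩
    rw [E.calA_eq_calA u v hu hv c a]
    exact hpA j (by omega) (by omega)
  · exact (mul_le_of_le_one_left hι (min_le_left _ _)).trans hIA
  · have h3 : ε ≤ 2 * K * ι := by
      rw [div_div, div_le_iff₀ (by positivity)] at hI
      linarith
    have h4 : 2 * K * ε ≤ 2 * K * (2 * K * ι) :=
      mul_le_mul_of_nonneg_left h3 (by positivity)
    have h5 : 0 ≤ 2 * K * ι := by positivity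
    linarith
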